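/- Notation. Let $d\ge 1$, let $\mathbb S^{d-1}\subset\mathbb R^d$ be the unit sphere with geodesic distance $d_g(x,y)=\arccos\langle x,y\rangle$, and let $\mathsf W_2$ be the quadratic Wasserstein distance on $\mathcal P(\mathbb S^{d-1})$ for $d_g$. A set $K\subset\mathbb S^{d-1}$ is geodesically convex if it contains every minimizing geodesic between two of its points (that is, $x,y\in K$ and $d_g(x,z)+d_g(z,y)=d_g(x,y)$ imply $z\in K$); $\mathrm{conv}_g A$ is the smallest geodesically convex set containing $A$. For parameters $V,B,W,U:[0,T]\to\mathbb R^{d\times d}$ and $b:[0,T]\to\mathbb R^d$ consider the Cauchy problem $$\partial_t\mu(t)+\mathrm{div}\big(\mu(t)\,\mathsf v[\mu(t)]\big)=0\ \text{ on }[0,T]\times\mathbb S^{d-1},\qquad \mu(0)=\mu_0,$$ $$\mathsf v[\mu](t,x)=(I_d-xx^\top)\Big(V(t)\,\frac{\int e^{\langle B(t)x,y\rangle}y\,\mu(\mathrm dy)}{\int e^{\langle B(t)x,y\rangle}\mu(\mathrm dy)}+W(t)\big(U(t)x+b(t)\big)_+\Big),$$ where $(\cdot)_+$ is the componentwise positive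 part; solutions are weak solutions $\mu\in C^0([0,T];\mathcal P(\mathbb S^{d-1}))$. Proposition 2.2. Let $\mu_0^1,\dots,\mu_0^N\in\mathcal P(\mathbb S^{d-1})$ have no atoms, with $\mathrm{conv}_g\,\mathrm{supp}\,\mu_0^i\cap\mathrm{conv}_g\,\mathrm{supp}\,\mu_0^j=\varnothing$ for $i\ne j$. Fix $M\ge1$ and, for each $i$, let $$\mu_1^i=\sum_{k=1}^M\alpha_k^i\,\delta_{x_k^i},\qquad \alpha_k^i\ge0,\quad \sum_{k=1}^M\alpha_k^i=1,\quad x_k^i\in\mathrm{conv}_g\,\mathrm{supp}\,\mu_0^i,$$ where $x_k^i=x_{k'}^j$ if and only if $(k,i)=(k',j)$. Then for all $T>0$ and $\varepsilon>0$ there exist piecewise constant $(W,U,b):[0,T]\to\mathbb R^{d\times d}\times\mathbb R^{d\times d}\times\mathbb R^d$ (finitely many pieces) such that, with $V\equiv0$ and these parameters ($B$ being irrelevant), for every $i$ the problem with data $\mu_0^i$ has a solution, and the corresponding solutions $\mu^i$ satisfy $$\mathsf W_2\big(\mu^i(T),\mu_1^i\big)\le\varepsilon\quad\text{for all }i,\qquad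 \mathrm{conv}_g\,\mathrm{supp}\,\mu^i(T)\cap\mathrm{conv}_g\,\mathrm{supp}\,\mu^j(T)=\varnothing\quad\text{for all }i\neq j.$$ -/

import Mathlib

open MeasureTheory Set
open scoped ENNReal

noncomputable section

namespace TransformerFlow

/-- Ambient Euclidean space `ℝ^d`. -/
abbrev E (d : ℕ) : Type := EuclideanSpace ℝ (Fin d)

/-- The unit sphere of `ℝ^d`. -/
abbrev S (d : ℕ) : Type := Metric.sphere (0 : E d) 1

/-- The geodesic (great circle) distance `arccos ⟪x, y⟫` on the unit sphere. -/
def geodDist {d : ℕ} (x y : S d) : ℝ := InnerProductGeometry.angle (x : E d) (y : E d)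

/-- `K` is geodesically convex: it contains every minimizing geodesic joining two of its points.
A point `z` of the sphere lies on a minimizing geodesic from `x` to `y` exactly when
`d(x, z) + d(z, y) = d(x, y)`. -/
def GeodConvex {d : ℕ} (K : Set (S d)) : Prop :=
  ∀ x ∈ K, ∀ y ∈ K, ∀ z : S d, geodDist x z + geodDist z y = geodDist x y → z ∈ K

/-- The geodesic convex hull of `A`: the smallest geodesically convex set containing `A`. -/
def geodHull {d : ℕ} (A : Set (S d)) : Set (S d) :=
  ⋂₀ {K : Set (S d) | A ⊆ K ∧ GeodConvex K}

/-- The quadratic Wasserstein distance on the sphere, for the geodesic distance: the square root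
of the infimum of `∫ d(x, y)² dπ` over all couplings `π` of `μ` and `ν`. -/
def wasserstein2 {d : ℕ} (μ ν : Measure (S d)) : ℝ≥0∞ :=
  (⨅ π ∈ {π : Measure (S d × S d) | π.map Prod.fst = μ ∧ π.map Prod.snd = ν},
    ∫⁻ p, ENNReal.ofReal (geodDist p.1 p.2 ^ 2) ∂π) ^ (1 / 2 : ℝ)

/-- The parameters of one layer. -/
structure Params (d : ℕ) where
  V : Matrix (Fin d) (Fin d) ℝ
  B : Matrix (Fin d) (Fin d) ℝ
  W : Matrix (Fin d) (Fin d) ℝ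
  U : Matrix (Fin d) (Fin d) ℝ
  b : E d

/-- A matrix acting on a vector of Euclidean space. -/
def act {d : ℕ} (A : Matrix (Fin d) (Fin d) ℝ) (x : E d) : E d :=
  WithLp.toLp 2 (A.mulVec (WithLp.ofLp x))

/-- The componentwise positive part (ReLU). -/
def relu {d : ℕ} (x : E d) : E d := WithLp.toLp 2 (fun k => max (x k) 0)

/-- The orthogonal projection `I - x xᵀ` onto the tangent space of the sphere at `x`. -/
def proj {d : ℕ} (x : S d) (v : E d) : E d := v - inner ℝ (x : E d) v • (x : E d)

/-- Self-attention `∫ e^⟪B x, y⟫ y μ(dy) / ∫ e^⟪B x, y⟫ μ(dy)`. -/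
def attention {d : ℕ} (B : Matrix (Fin d) (Fin d) ℝ) (μ : Measure (S d)) (x : S d) : E d :=
  (∫ y : S d, Real.exp (inner ℝ (act B (x : E d)) (y : E d)) ∂μ)⁻¹ •
    ∫ y : S d, Real.exp (inner ℝ (act B (x : E d)) (y : E d)) • (y : E d) ∂μ

/-- The velocity field `P_x (V 𝒜_B[μ](x) + W (U x + b)₊)`. -/
def velocity {d : ℕ} (θ : Params d) (μ : Measure (S d)) (x : S d) : E d :=
  proj x (act θ.V (attention θ.B μ x) + act θ.W (relu (act θ.U (x : E d) + θ.b)))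

/-- `μ ∈ C⁰([0,T]; 𝒫(S))` (weak convergence of measures) is a weak solution on `[0,T]` of
`∂ₜ μ + div (μ v[μ]) = 0`, `μ(0) = μ₀`. The test functions are the restrictions to the sphere of
`C¹` functions on `ℝ^d`; since the velocity is tangent to the sphere, pairing it with the spherical
gradient of `φ` at `x` amounts to applying the differential of `φ` at `x` to it. Only the values
of `μ` and `θ` on `[0,T]` matter. -/
structure IsWeakSolution {d : ℕ} (T : ℝ) (θ : ℝ → Params d) (μ₀ : ProbabilityMeasure (S d))
    (μ : ℝ → ProbabilityMeasure (S d)) : Prop where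
  continuousOn : ContinuousOn μ (Icc 0 T)
  initial : μ 0 = μ₀
  integrable : ∀ φ : E d → ℝ, ContDiff ℝ 1 φ →
    IntervalIntegrable (fun s => ∫ x : S d,
      fderiv ℝ φ (x : E d) (velocity (θ s) (μ s : Measure (S d)) x) ∂(μ s : Measure (S d)))
      volume 0 T
  weak : ∀ φ : E d → ℝ, ContDiff ℝ 1 φ → ∀ t ∈ Icc (0 : ℝ) T,
    ∫ x : S d, φ (x : E d) ∂(μ t : Measure (S d)) =
      ∫ x : S d, φ (x : E d) ∂(μ₀ : Measure (S d)) +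
      ∫ s in (0 : ℝ)..t, ∫ x : S d,
        fderiv ℝ φ (x : E d) (velocity (θ s) (μ s : Measure (S d)) x) ∂(μ s : Measure (S d))

/-- `f` is piecewise constant on `[0,T]`: there are `0 = t₀ < t₁ < ⋯ < tₙ = T` such that `f` is
constant on each `[tₖ, tₖ₊₁)`. -/
def PiecewiseConstant {α : Type*} (T : ℝ) (f : ℝ → α) : Prop :=
  ∃ (n : ℕ) (t : Fin (n + 1) → ℝ), StrictMono t ∧ t 0 = 0 ∧ t (Fin.last n) = T ∧
    ∀ k : Fin n, ∃ c : α, ∀ s ∈ Ico (t k.castSucc) (t k.succ), f s = c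

end TransformerFlow

end

open Filter Topology
open scoped NNReal

namespace TransformerFlow

/-! With `V = 0` the velocity does not depend on `μ`, so a layer acts on every datum by one flow on
the sphere, and the solution is the push-forward of the datum by that flow. It suffices to build a
single map, a composition of time-one maps of layers (`Realizable`), which sends each `μ₀ i` close
to its target and maps each hull `C i` into itself.

The building block is a rank-one layer, whose field is a nonnegative multiple of `(⟪a, x⟫ - c)₊ P_x
w` (`exists_cap_flow`). It slides the points of a cap along geodesics towards `w` and fixes all the
others. Composing such flows over a finite cover by caps and iterating collapses a compact set,
star-shaped about `w`, into any neighbourhood of `w` without moving a disjoint closed set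
(`exists_collapse`). Since all motion is along geodesics towards points of `C i`, geodesic convexity
keeps `C i` invariant. Geodesic hulls of closed sets are closed (`isClosed_geodHull`), so the other
hulls can serve as the fixed set.

For one datum, almost all the mass is first gathered in a small blob near a point `p`. The blob is
then cut into slices of the prescribed masses, each of which is collapsed to its target, the targets
farthest from `p` being served first (`exists_slice`, `exists_distribution`, `exists_steering`). A
slice is a superlevel set of a ratio of two linear forms which increases along the geodesics to the
target. Its level sets are null for a generic choice, because the measure has no atoms. The maps
obtained for the different data fix each other's hulls, so their composition treats all data at once
(`exists_simultaneous`).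

The conclusion concerns every weak solution, hence uniqueness is needed. It follows by comparing
solutions with an explicit Euler scheme for the dual transport equation
(`IsAutonomousSolution.unique`). -/

variable {d : ℕ}

/-! ### Geodesics, stars and geodesic hulls on the sphere. -/

/-- `z` lies on a minimizing geodesic from `x` to `y`. -/
def Btw (x z y : S d) : Prop := geodDist x z + geodDist z y = geodDist x y

lemma norm_coe_sphere (x : S d) : ‖(x : E d)‖ = 1 := by simp

lemma coe_sphere_ne_zero (x : S d) : (x : E d) ≠ 0 := by
  intro h; have := norm_coe_sphere x; simp [h] at this

lemma inner_self_sphere (x : S d) : inner ℝ (x : E d) (x : E d) = (1 : ℝ) := by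
  rw [real_inner_self_eq_norm_sq, norm_coe_sphere]; norm_num

lemma geodDist_comm (x y : S d) : geodDist x y = geodDist y x :=
  InnerProductGeometry.angle_comm _ _

lemma geodDist_self (x : S d) : geodDist x x = 0 :=
  InnerProductGeometry.angle_self (coe_sphere_ne_zero x)

lemma geodDist_nonneg (x y : S d) : 0 ≤ geodDist x y := InnerProductGeometry.angle_nonneg _ _

lemma geodDist_le_pi (x y : S d) : geodDist x y ≤ Real.pi := InnerProductGeometry.angle_le_pi _ _

lemma geodDist_triangle (x y z : S d) : geodDist x z ≤ geodDist x y + geodDist y z :=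
  InnerProductGeometry.angle_le_angle_add_angle _ _ _

lemma geodDist_eq_zero_iff {x y : S d} : geodDist x y = 0 ↔ x = y := by
  constructor
  · intro h
    apply Subtype.ext
    exact InnerProductGeometry.eq_of_angle_eq_zero_of_norm_eq h
      (by rw [norm_coe_sphere, norm_coe_sphere])
  · rintro rfl; exact geodDist_self x

lemma geodDist_pos {x y : S d} (h : x ≠ y) : 0 < geodDist x y :=
  lt_of_le_of_ne (geodDist_nonneg x y) fun h' => h (geodDist_eq_zero_iff.1 h'.symm)

lemma continuous_geodDist : Continuous fun p : S d × S d => geodDist p.1 p.2 := by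
  rw [continuous_iff_continuousAt]
  intro p
  have := InnerProductGeometry.continuousAt_angle (x := ((p.1 : E d), (p.2 : E d)))
    (coe_sphere_ne_zero _) (coe_sphere_ne_zero _)
  exact ContinuousAt.comp (f := fun p : S d × S d => ((p.1 : E d), (p.2 : E d))) this
    (by fun_prop)

lemma continuous_geodDist_right (w : S d) : Continuous fun x : S d => geodDist x w := by
  have h : Continuous fun x : S d => (x, w) := continuous_id.prodMk continuous_const
  have h' := continuous_geodDist.comp h
  exact h'

lemma geodDist_eq_pi_iff {x y : S d} : geodDist x y = Real.pi ↔ (y : E d) = -(x : E d) := by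
  unfold geodDist
  rw [InnerProductGeometry.angle_eq_pi_iff]
  constructor
  · rintro ⟨-, r, hr, h⟩
    have h1 := norm_coe_sphere y
    rw [h, norm_smul, norm_coe_sphere, Real.norm_eq_abs, abs_of_neg hr] at h1
    have : r = -1 := by linarith
    rw [h, this]; simp
  · intro h
    exact ⟨coe_sphere_ne_zero x, -1, by norm_num, by simp [h]⟩

lemma btw_left (x y : S d) : Btw x x y := by simp [Btw, geodDist_self]

/-- Angles add up exactly when the endpoints are antipodal or the middle vector lies in the cone
they span. Metric betweenness thus becomes linear algebra, here and in `Btw.exists_combination`. -/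
lemma btw_of_combination {x z y : S d} {α β : ℝ} (hα : 0 ≤ α) (hβ : 0 ≤ β)
    (h : (z : E d) = α • (x : E d) + β • (y : E d)) : Btw x z y := by
  unfold Btw geodDist
  symm
  rw [InnerProductGeometry.angle_eq_angle_add_angle_iff (coe_sphere_ne_zero z)]
  right
  rw [Submodule.mem_span_pair]
  exact ⟨⟨α, hα⟩, ⟨β, hβ⟩, h.symm⟩

lemma Btw.exists_combination {x z y : S d} (h : Btw x z y) (hxy : (y : E d) ≠ -(x : E d)) :
    ∃ α β : ℝ, 0 ≤ α ∧ 0 ≤ β ∧ (z : E d) = α • (x : E d) + β • (y : E d) := by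
  unfold Btw geodDist at h
  have h := (InnerProductGeometry.angle_eq_angle_add_angle_iff (coe_sphere_ne_zero z)).1 h.symm
  rcases h with h | h
  · exact absurd (geodDist_eq_pi_iff.1 h) hxy
  · rw [Submodule.mem_span_pair] at h
    obtain ⟨a, b, h⟩ := h
    exact ⟨a, b, a.2, b.2, h.symm⟩

lemma btw_of_antipodal {x y : S d} (h : (y : E d) = -(x : E d)) (z : S d) : Btw x z y := by
  unfold Btw geodDist
  symm
  rw [InnerProductGeometry.angle_eq_angle_add_angle_iff (coe_sphere_ne_zero z)]
  left
  exact geodDist_eq_pi_iff.2 h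

/-- Concatenation of geodesics ending at a common point. -/
lemma Btw.trans {x z z' y : S d} (h : Btw x z y) (h' : Btw z z' y) : Btw x z' y := by
  unfold Btw at *
  have h1 := geodDist_triangle x z z'
  have h2 := geodDist_triangle x z' y
  linarith

lemma isClosed_btw (y : S d) : IsClosed {p : S d × S d | Btw p.1 p.2 y} := by
  unfold Btw
  refine isClosed_eq ?_ ?_
  · exact continuous_geodDist.add ((continuous_geodDist_right y).comp continuous_snd)
  · exact (continuous_geodDist_right y).comp continuous_fst

/-- The union of the minimizing geodesics from points of `L` to `w`. -/
def starHull (w : S d) (L : Set (S d)) : Set (S d) := {z | ∃ x ∈ L, Btw x z w}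

lemma subset_starHull (w : S d) (L : Set (S d)) : L ⊆ starHull w L :=
  fun x hx => ⟨x, hx, btw_left x w⟩

lemma isCompact_starHull (w : S d) {L : Set (S d)} (hL : IsClosed L) :
    IsCompact (starHull w L) := by
  have : starHull w L = Prod.snd '' ({p : S d × S d | Btw p.1 p.2 w} ∩ Prod.fst ⁻¹' L) := by
    ext z
    constructor
    · rintro ⟨x, hx, h⟩; exact ⟨(x, z), ⟨h, hx⟩, rfl⟩
    · rintro ⟨⟨x, z'⟩, ⟨h, hx⟩, rfl⟩; exact ⟨x, hx, h⟩
  rw [this]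
  exact ((isClosed_btw w).inter (hL.preimage continuous_fst)).isCompact.image continuous_snd

lemma GeodConvex.starHull_subset {C : Set (S d)} (hC : GeodConvex C) {w : S d} (hw : w ∈ C)
    {L : Set (S d)} (hL : L ⊆ C) : starHull w L ⊆ C := by
  rintro z ⟨x, hx, h⟩
  exact hC x (hL hx) w hw z h

lemma starHull_btw {w : S d} {L : Set (S d)} {x z : S d} (hx : x ∈ starHull w L)
    (h : Btw x z w) : z ∈ starHull w L := by
  obtain ⟨y, hy, h'⟩ := hx
  exact ⟨y, hy, h'.trans h⟩

lemma subset_geodHull (A : Set (S d)) : A ⊆ geodHull A :=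
  fun _ hx => mem_sInter.2 fun _ hK => hK.1 hx

lemma geodConvex_geodHull (A : Set (S d)) : GeodConvex (geodHull A) := by
  intro x hx y hy z hz
  refine mem_sInter.2 fun K hK => ?_
  exact hK.2 x (mem_sInter.1 hx K hK) y (mem_sInter.1 hy K hK) z hz

lemma geodHull_subset {A K : Set (S d)} (hA : A ⊆ K) (hK : GeodConvex K) : geodHull A ⊆ K :=
  sInter_subset_of_mem ⟨hA, hK⟩

lemma GeodConvex.eq_univ_of_antipodal {K : Set (S d)} (hK : GeodConvex K) {x y : S d}
    (hx : x ∈ K) (hy : y ∈ K) (h : (y : E d) = -(x : E d)) : K = univ :=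
  eq_univ_of_forall fun z => hK x hx y hy z (btw_of_antipodal h z)

/-! ### Compact convex hulls, and closedness of geodesic hulls. -/

lemma isCompact_convexJoin {V : Type*} [AddCommGroup V] [Module ℝ V] [TopologicalSpace V]
    [ContinuousAdd V] [ContinuousSMul ℝ V] {s t : Set V} (hs : IsCompact s) (ht : IsCompact t) :
    IsCompact (convexJoin ℝ s t) := by
  have : convexJoin ℝ s t = (fun p : (V × V) × ℝ => (1 - p.2) • p.1.1 + p.2 • p.1.2) ''
      ((s ×ˢ t) ×ˢ Icc (0 : ℝ) 1) := by
    ext z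
    simp only [mem_convexJoin, segment_eq_image, mem_image, Prod.exists, mem_prod]
    constructor
    · rintro ⟨a, ha, b, hb, θ, hθ, rfl⟩; exact ⟨a, b, θ, ⟨⟨ha, hb⟩, hθ⟩, rfl⟩
    · rintro ⟨a, b, θ, ⟨⟨ha, hb⟩, hθ⟩, rfl⟩; exact ⟨a, ha, b, hb, θ, hθ, rfl⟩
  rw [this]
  exact ((hs.prod ht).prod isCompact_Icc).image (by fun_prop)

/-- By induction, iterated convex joins of `A` with itself are compact and contain the hulls of all
subsets of at most `n + 1` points. By Carathéodory, `n = finrank` reaches the whole hull. -/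
lemma isCompact_convexHull_of_finiteDimensional {V : Type*} [NormedAddCommGroup V]
    [NormedSpace ℝ V] [FiniteDimensional ℝ V] {A : Set V} (hA : IsCompact A) :
    IsCompact (convexHull ℝ A) := by
  rcases A.eq_empty_or_nonempty with rfl | hne
  · simp
  have key : ∀ n : ℕ, ∃ K : Set V, IsCompact K ∧ K ⊆ convexHull ℝ A ∧
      ∀ t : Finset V, ↑t ⊆ A → t.card ≤ n + 1 → convexHull ℝ (t : Set V) ⊆ K := by
    intro n
    induction n with
    | zero =>
      refine ⟨A, hA, subset_convexHull ℝ A, fun t ht hc => ?_⟩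
      rcases t.eq_empty_or_nonempty with rfl | htn
      · simp
      obtain ⟨a, rfl⟩ := Finset.card_eq_one.1 (le_antisymm hc htn.card_pos)
      simpa using ht
    | succ n ih =>
      obtain ⟨K, hK, hKA, h⟩ := ih
      refine ⟨convexJoin ℝ A K, isCompact_convexJoin hA hK, ?_, fun t ht hc => ?_⟩
      · exact convexJoin_subset (subset_convexHull ℝ A) hKA (convex_convexHull ℝ A)
      classical
      rcases t.eq_empty_or_nonempty with rfl | ⟨a, ha⟩
      · simp
      have haA : a ∈ A := ht ha
      rcases (t.erase a).eq_empty_or_nonempty with he | he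
      · have : t = {a} := by
          rw [← Finset.insert_erase ha, he]; rfl
        subst this
        have haK : a ∈ K := by
          have := h {a} (by simpa using haA) (by simp)
          simpa using this
        simpa using subset_convexJoin_left ⟨a, haK⟩ haA
      · have hte : ((t.erase a : Finset V) : Set V) ⊆ A :=
          fun x hx => ht (Finset.mem_of_mem_erase hx)
        have hce : (t.erase a).card ≤ n + 1 := by
          rw [Finset.card_erase_of_mem ha]; omega
        have h2 := h _ hte hce
        rw [← Finset.insert_erase ha, Finset.coe_insert, convexHull_insert (by exact_mod_cast he)]
        exact convexJoin_mono (by simpa using haA) h2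
  obtain ⟨K, hK, hKA, h⟩ := key (Module.finrank ℝ V)
  have : convexHull ℝ A = K := by
    refine Subset.antisymm ?_ hKA
    rw [convexHull_eq_union]
    simp only [iUnion_subset_iff]
    intro t ht hi
    exact h t ht (by
      have h1 := hi.card_le_finrank_succ
      have h2 := Submodule.finrank_le (vectorSpan ℝ (range ((↑) : t → V)))
      simp only [Fintype.card_coe] at h1
      omega)
  rw [this]; exact hK

/-- The radial projection to the sphere of a nonzero vector. -/
noncomputable def normalizeS (x : E d) (hx : x ≠ 0) : S d :=
  ⟨‖x‖⁻¹ • x, by simp [norm_smul, inv_mul_cancel₀ (norm_ne_zero_iff.2 hx)]⟩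

lemma sphere_eq_of_smul {x y : S d} {r : ℝ} (hr : 0 < r) (h : (x : E d) = r • (y : E d)) :
    x = y := by
  have h1 := norm_coe_sphere x
  rw [h, norm_smul, norm_coe_sphere, Real.norm_eq_abs, abs_of_pos hr] at h1
  apply Subtype.ext
  rw [h]; simp [show r = 1 by linarith]

/-- A hull containing two antipodal points is the whole sphere. Otherwise the open cone `Q` over it
is convex and misses `0`, so the compact linear hull `H` of `A` also misses `0`. The radial
projection `D` of `H` is then compact, geodesically convex and squeezed between `A` and the hull,
hence equal to the hull. -/
lemma isClosed_geodHull {A : Set (S d)} (hA : IsClosed A) : IsClosed (geodHull A) := by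
  by_cases hanti : ∃ x ∈ geodHull A, ∃ y ∈ geodHull A, (y : E d) = -(x : E d)
  · obtain ⟨x, hx, y, hy, h⟩ := hanti
    rw [(geodConvex_geodHull A).eq_univ_of_antipodal hx hy h]
    exact isClosed_univ
  push Not at hanti
  set Q : Set (E d) := {z | ∃ c ∈ geodHull A, ∃ t : ℝ, 0 < t ∧ z = t • (c : E d)} with hQ
  have hQconv : Convex ℝ Q := by
    rw [convex_iff_add_mem]
    rintro _ ⟨c, hc, t, ht, rfl⟩ _ ⟨c', hc', t', ht', rfl⟩ a b ha hb hab
    rcases ha.eq_or_lt with rfl | ha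
    · simp only [zero_add] at hab; subst hab
      exact ⟨c', hc', t', ht', by simp⟩
    rcases hb.eq_or_lt with rfl | hb
    · simp only [add_zero] at hab; subst hab
      exact ⟨c, hc, t, ht, by simp⟩
    set z := a • t • (c : E d) + b • t' • (c' : E d) with hz
    have hz0 : z ≠ 0 := by
      intro h0
      rw [hz, smul_smul, smul_smul, add_eq_zero_iff_eq_neg] at h0
      have h1 : (c : E d) = ((a * t)⁻¹ * (b * t')) • (-(c' : E d)) := by
        rw [mul_smul, smul_neg, ← h0, smul_smul, inv_mul_cancel₀ (by positivity), one_smul]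
      have h2 := norm_coe_sphere c
      have h3 : 0 < (a * t)⁻¹ * (b * t') := by positivity
      rw [h1, norm_smul, norm_neg, norm_coe_sphere, Real.norm_eq_abs, abs_of_pos h3] at h2
      rw [show (a * t)⁻¹ * (b * t') = 1 by linarith, one_smul] at h1
      exact hanti c' hc' c hc h1
    refine ⟨normalizeS z hz0, ?_, ‖z‖, norm_pos_iff.2 hz0, ?_⟩
    · refine geodConvex_geodHull A c hc c' hc' _ (btw_of_combination
        (α := ‖z‖⁻¹ * (a * t)) (β := ‖z‖⁻¹ * (b * t')) (by positivity) (by positivity) ?_)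
      simp only [normalizeS, hz, smul_add, smul_smul]
    · simp only [normalizeS, smul_smul]
      rw [mul_inv_cancel₀ (norm_ne_zero_iff.2 hz0), one_smul]
  set H : Set (E d) := convexHull ℝ ((↑) '' A) with hH
  have hHQ : H ⊆ Q := by
    refine convexHull_min ?_ hQconv
    rintro _ ⟨x, hx, rfl⟩
    exact ⟨x, subset_geodHull A hx, 1, one_pos, by simp⟩
  have hHc : IsCompact H :=
    isCompact_convexHull_of_finiteDimensional (hA.isCompact.image continuous_subtype_val)
  have hQ0 : ∀ z ∈ Q, z ≠ 0 := by
    rintro _ ⟨c, hc, t, ht, rfl⟩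
    exact smul_ne_zero ht.ne' (coe_sphere_ne_zero c)
  set D : Set (S d) := {x | ∃ z ∈ H, ∃ t : ℝ, 0 < t ∧ z = t • (x : E d)} with hD
  have hDeq : geodHull A = D := by
    apply Subset.antisymm
    · refine geodHull_subset ?_ ?_
      · intro x hx
        exact ⟨x, subset_convexHull ℝ _ ⟨x, hx, rfl⟩, 1, one_pos, by simp⟩
      · rintro x ⟨zx, hzx, t, ht, hx⟩ y ⟨zy, hzy, t', ht', hy⟩ z hz
        by_cases hxy : (y : E d) = -(x : E d)
        · exfalso
          -- These weights make the two opposite vectors `t • x` and `-t' • x` cancel, which would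
          -- put `0` in `H`.
          have h0 : (t' / (t + t')) • zx + (t / (t + t')) • zy ∈ H := by
            refine convex_iff_add_mem.1 (convex_convexHull ℝ _) hzx hzy (by positivity)
              (by positivity) ?_
            field_simp; ring
          refine hQ0 _ (hHQ h0) ?_
          rw [hx, hy, hxy, smul_neg, smul_neg, smul_smul, smul_smul, ← sub_eq_add_neg, ← sub_smul]
          rw [show t' / (t + t') * t - t / (t + t') * t' = 0 by field_simp; ring, zero_smul]
        · obtain ⟨α, β, hα, hβ, h⟩ := Btw.exists_combination hz hxy
          have hpos : 0 < α / t + β / t' := by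
            rcases hα.eq_or_lt with rfl | hα
            · rcases hβ.eq_or_lt with rfl | hβ
              · exact absurd (by simpa using h) (coe_sphere_ne_zero z)
              · positivity
            · positivity
          set s := α / t + β / t' with hs
          refine ⟨(α / t / s) • zx + (β / t' / s) • zy, ?_, s⁻¹, by positivity, ?_⟩
          · refine convex_iff_add_mem.1 (convex_convexHull ℝ _) hzx hzy (by positivity)
              (by positivity) ?_
            rw [← add_div, ← hs, div_self hpos.ne']
          · rw [h, hx, hy, smul_add, smul_smul, smul_smul, smul_smul, smul_smul]
            congr 2 <;> field_simp
    · rintro x ⟨z, hz, t, ht, h⟩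
      obtain ⟨c, hc, s, hs, h'⟩ := hHQ hz
      have : x = c := by
        refine sphere_eq_of_smul (r := t⁻¹ * s) (by positivity) ?_
        rw [mul_smul, ← h', h, smul_smul, inv_mul_cancel₀ ht.ne', one_smul]
      rwa [this]
  rw [hDeq]
  have hDim : ((↑) : S d → E d) '' D = (fun z : E d => ‖z‖⁻¹ • z) '' H := by
    ext y
    constructor
    · rintro ⟨x, ⟨z, hz, t, ht, h⟩, rfl⟩
      refine ⟨z, hz, ?_⟩
      simp only [h, norm_smul, norm_coe_sphere, Real.norm_eq_abs, abs_of_pos ht, mul_one, smul_smul,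
        inv_mul_cancel₀ ht.ne', one_smul]
    · rintro ⟨z, hz, rfl⟩
      have hz0 := hQ0 z (hHQ hz)
      refine ⟨normalizeS z hz0, ⟨z, hz, ‖z‖, norm_pos_iff.2 hz0, ?_⟩, rfl⟩
      simp only [normalizeS, smul_smul]
      rw [mul_inv_cancel₀ (norm_ne_zero_iff.2 hz0), one_smul]
  have hcl : IsClosed (((↑) : S d → E d) '' D) := by
    rw [hDim]
    refine (hHc.image_of_continuousOn ?_).isClosed
    refine ContinuousOn.smul (ContinuousOn.inv₀ continuous_norm.continuousOn ?_) continuousOn_id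
    intro z hz; exact norm_ne_zero_iff.2 (hQ0 z (hHQ hz))
  have := hcl.preimage (continuous_subtype_val (p := fun x => x ∈ Metric.sphere (0 : E d) 1))
  rwa [preimage_image_eq _ Subtype.val_injective] at this

/-! ### The flow of a single rank-one layer. -/

/-- The velocity field `P_x W (U x + b)₊` of a layer without self-attention. -/
noncomputable def vel (W U : Matrix (Fin d) (Fin d) ℝ) (b : E d) (x : S d) : E d :=
  proj x (act W (relu (act U (x : E d) + b)))

lemma velocity_zero_eq (B W U : Matrix (Fin d) (Fin d) ℝ) (b : E d) (μ : Measure (S d)) (x : S d) :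
    velocity ⟨0, B, W, U, b⟩ μ x = vel W U b x := by
  have : act (0 : Matrix (Fin d) (Fin d) ℝ) (attention B μ x) = 0 := by
    simp [act]
  simp [velocity, vel, this]

/-- `Φ` is the flow of the layer `(W, U, b)` on the time interval `[0,1]`, extended by constants. -/
structure IsFlow (W U : Matrix (Fin d) (Fin d) ℝ) (b : E d) (Φ : ℝ → S d → S d) : Prop where
  continuous : Continuous fun p : ℝ × S d => Φ p.1 p.2
  of_nonpos : ∀ t ≤ 0, ∀ x, Φ t x = x
  of_one_le : ∀ t, 1 ≤ t → ∀ x, Φ t x = Φ 1 x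
  injective : Function.Injective (Φ 1)
  hasDeriv : ∀ x, ∀ t ∈ Ico (0 : ℝ) 1,
    HasDerivWithinAt (fun s => (Φ s x : E d)) (vel W U b (Φ t x)) (Ici t) t

/-- An extension to `ℝ^d` of the field `r (⟪a, x⟫ - c)₊ P_x w`, tangent to every sphere. -/
noncomputable def capField (r c : ℝ) (a w : E d) (x : E d) : E d :=
  (r * max (inner ℝ a x - c) 0) • (‖x‖ ^ 2 • w - inner ℝ x w • x)

lemma capField_eq_smul (r c : ℝ) (a w x : E d) : capField r c a w x = r • capField 1 c a w x := by
  simp [capField, smul_smul]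

lemma locallyLipschitz_capField (r c : ℝ) (a w : E d) : LocallyLipschitz (capField r c a w) := by
  have h1 : LocallyLipschitz fun x : E d => max (inner ℝ a x - c) 0 := by
    apply LocallyLipschitz.max_const
    have : ContDiff ℝ 1 fun x : E d => inner ℝ a x - c :=
      (contDiff_const.inner ℝ contDiff_id).sub contDiff_const
    exact this.locallyLipschitz
  have h2 : LocallyLipschitz fun p : ℝ × E d =>
      (r * p.1) • (‖p.2‖ ^ 2 • w - inner ℝ p.2 w • p.2) := by
    have : ContDiff ℝ 1 fun p : ℝ × E d =>
        (r * p.1) • (‖p.2‖ ^ 2 • w - (inner ℝ p.2 w : ℝ) • p.2) := by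
      have h3 : ContDiff ℝ 1 fun p : ℝ × E d => ‖p.2‖ ^ 2 := contDiff_snd.norm_sq ℝ
      have h4 : ContDiff ℝ 1 fun p : ℝ × E d => (inner ℝ p.2 w : ℝ) :=
        contDiff_snd.inner ℝ contDiff_const
      fun_prop
    exact this.locallyLipschitz
  have h3 := h2.comp (h1.prodMk LocallyLipschitz.id)
  exact h3

lemma inner_capField (r c : ℝ) (a w x : E d) : inner ℝ x (capField r c a w x) = (0 : ℝ) := by
  simp only [capField, inner_smul_right, inner_sub_right, real_inner_self_eq_norm_sq]
  ring

/-- One neuron is enough: `U = e_k aᵀ` and `b = -c e_k` leave only the `k`-th coordinate of the ReLU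
possibly nonzero, and `W = r w e_kᵀ` reads it off in the direction `w`. -/
lemma exists_vel_eq_capField (r c : ℝ) (a : E d) (w : S d) :
    ∃ (W U : Matrix (Fin d) (Fin d) ℝ) (b : E d), ∀ x : S d,
      vel W U b x = capField r c a w x := by
  have hd : Nonempty (Fin d) := by
    by_contra h
    rw [not_nonempty_iff] at h
    exact coe_sphere_ne_zero w (Subsingleton.elim _ _)
  obtain ⟨k⟩ := hd
  refine ⟨r • Matrix.vecMulVec (WithLp.ofLp (w : E d)) (Pi.single k 1),
    Matrix.vecMulVec (Pi.single k 1) (WithLp.ofLp a), WithLp.toLp 2 (Pi.single k (-c)), fun x => ?_⟩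
  have h1 : act (r • Matrix.vecMulVec (WithLp.ofLp (w : E d)) (Pi.single k 1))
      (relu (act (Matrix.vecMulVec (Pi.single k 1) (WithLp.ofLp a)) (x : E d) +
        WithLp.toLp 2 (Pi.single k (-c)))) = (r * max (inner ℝ a (x : E d) - c) 0) • (w : E d) := by
    have h3 : (WithLp.ofLp a) ⬝ᵥ (WithLp.ofLp (x : E d)) = inner ℝ a (x : E d) := by
      simp [PiLp.inner_apply, dotProduct, mul_comm]
    ext j
    simp only [act, relu, Matrix.smul_mulVec, Matrix.vecMulVec_mulVec, h3]
    simp [sub_eq_add_neg]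
    ring
  rw [vel, h1, proj, capField]
  rw [norm_coe_sphere, inner_smul_right, smul_sub, smul_smul, smul_smul]
  simp

/-- The field is tangent to all spheres centred at `0`, so norms are conserved. The identity `A • α
(x, 1) = x + s • w` says that the endpoint lies in the cone spanned by `x` and `w`, that is, on the
geodesic from `x` to `w`. Injectivity is uniqueness for the ODE run backwards. -/
lemma capField_flow (r c : ℝ) (hr : 0 < r) (a : E d) (w : E d)
    (hbound : ∀ x ∈ Metric.closedBall (0 : E d) 2, ‖capField r c a w x‖ ≤ 1) :
    ∃ α : E d × ℝ → E d, ContinuousOn α (Metric.closedBall 0 1 ×ˢ Icc 0 1) ∧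
      (∀ x ∈ Metric.sphere (0 : E d) 1, ∀ y ∈ Metric.sphere (0 : E d) 1,
        α (x, 1) = α (y, 1) → x = y) ∧
      ∀ x ∈ Metric.sphere (0 : E d) 1, α (x, 0) = x ∧
      (∀ t ∈ Icc (0 : ℝ) 1, α (x, t) ∈ Metric.sphere (0 : E d) 1) ∧
      (∀ t ∈ Ico (0 : ℝ) 1,
        HasDerivWithinAt (fun s => α (x, s)) (capField r c a w (α (x, t))) (Ici t) t) ∧
      (∃ A s : ℝ, 0 < A ∧ 0 ≤ s ∧ A • α (x, 1) = x + s • w ∧ (c < inner ℝ a x → 0 < s)) ∧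
      (inner ℝ a x ≤ c → α (x, 1) = x) := by
  obtain ⟨K, hK⟩ := LocallyLipschitzOn.exists_lipschitzOnWith_of_compact
    (isCompact_closedBall (0 : E d) 2) (locallyLipschitz_capField r c a w).locallyLipschitzOn
  -- Starting in the unit ball with speed at most 1, one stays in the ball of radius 2 up to time 1.
  have hPL : IsPicardLindelof (fun _ => capField r c a w)
      (⟨0, by simp⟩ : Icc (0 : ℝ) 1) (0 : E d) 2 1 1 K := by
    refine IsPicardLindelof.of_time_independent ?_ hK ?_
    · simpa using hbound
    · norm_num
  obtain ⟨α, hα, hcont⟩ :=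
    hPL.exists_forall_mem_closedBall_eq_hasDerivWithinAt_continuousOn
  have hsph' : ∀ x ∈ Metric.sphere (0 : E d) 1, ∀ t ∈ Icc (0 : ℝ) 1, ‖α (x, t)‖ = 1 := by
    intro x hx
    have hx1 : ‖x‖ = 1 := by simpa using hx
    obtain ⟨h0, hder⟩ := hα x (by simp [hx1])
    simp only at h0
    have hnorm : ∀ t ∈ Icc (0 : ℝ) 1, ‖α (x, t)‖ ^ 2 = ‖x‖ ^ 2 := by
      have := constant_of_has_deriv_right_zero (f := fun s => ‖α (x, s)‖ ^ 2) (a := 0) (b := 1)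
        (ContinuousOn.pow (ContinuousOn.norm fun t ht => (hder t ht).continuousWithinAt) 2)
        (fun t ht => by
          have := ((hder t (Ico_subset_Icc_self ht)).mono_of_mem_nhdsWithin
            (Icc_mem_nhdsGE_of_mem ht)).norm_sq
          rwa [inner_capField, mul_zero] at this)
      intro t ht
      rw [this t ht, h0]
    intro t ht
    have := hnorm t ht
    rw [hx1] at this
    nlinarith [norm_nonneg (α (x, t))]
  have hball : ∀ x ∈ Metric.sphere (0 : E d) 1, ∀ t ∈ Icc (0 : ℝ) 1,
      α (x, t) ∈ Metric.closedBall (0 : E d) 2 := fun x hx t ht => by simp [hsph' x hx t ht]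
  have hmem : ∀ x ∈ Metric.sphere (0 : E d) 1, x ∈ Metric.closedBall (0 : E d) ((1 : ℝ≥0) : ℝ) :=
    fun x hx => by simpa using Metric.sphere_subset_closedBall hx
  refine ⟨α, by simpa using hcont, fun x hx y hy hxy => ?_, fun x hx => ?_⟩
  · have hleft : ∀ z ∈ Metric.sphere (0 : E d) 1, ∀ t ∈ Ioc (0 : ℝ) 1,
        HasDerivWithinAt (fun s => α (z, s)) (capField r c a w (α (z, t))) (Iic t) t :=
      fun z hz t ht => ((hα z (hmem z hz)).2 t (Ioc_subset_Icc_self ht)).mono_of_mem_nhdsWithin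
        (Icc_mem_nhdsLE_of_mem ht)
    have hc : ∀ z ∈ Metric.sphere (0 : E d) 1, ContinuousOn (fun s => α (z, s)) (Icc 0 1) :=
      fun z hz t ht => ((hα z (hmem z hz)).2 t ht).continuousWithinAt
    have := ODE_solution_unique_of_mem_Icc_left (v := fun _ => capField r c a w)
      (s := fun _ => Metric.closedBall (0 : E d) 2) (K := K) (f := fun s => α (x, s))
      (g := fun s => α (y, s)) (a := 0) (b := 1) (fun t _ => hK) (hc x hx) (hleft x hx)
      (fun t ht => hball x hx t (Ioc_subset_Icc_self ht)) (hc y hy) (hleft y hy)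
      (fun t ht => hball y hy t (Ioc_subset_Icc_self ht)) hxy
    have h1 : α (x, 0) = α (y, 0) := this (by simp : (0 : ℝ) ∈ Icc (0 : ℝ) 1)
    have hx0 : α (x, 0) = x := (hα x (hmem x hx)).1
    have hy0 : α (y, 0) = y := (hα y (hmem y hy)).1
    rwa [hx0, hy0] at h1
  have hx1 : ‖x‖ = 1 := by simpa using hx
  obtain ⟨h0, hder⟩ := hα x (by simp [hx1])
  simp only at h0
  have hder' : ∀ t ∈ Ico (0 : ℝ) 1,
      HasDerivWithinAt (fun s => α (x, s)) (capField r c a w (α (x, t))) (Ici t) t := fun t ht =>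
    (hder t (Ico_subset_Icc_self ht)).mono_of_mem_nhdsWithin (Icc_mem_nhdsGE_of_mem ht)
  have hy : ContinuousOn (fun s => α (x, s)) (Icc 0 1) := fun t ht =>
    (hder t ht).continuousWithinAt
  have hsph := hsph' x hx
  refine ⟨h0, fun t ht => by simpa using hsph t ht, hder', ?_, ?_⟩
  -- Clamping the time makes the trajectory continuous on all of `ℝ`, so that the integrals below
  -- are differentiable everywhere.
  · set y : ℝ → E d := fun s => α (x, (projIcc 0 1 zero_le_one s : ℝ)) with hydef
    have hyc : Continuous y := by
      have h1 := continuousOn_iff_continuous_domRestrict.1 hy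
      exact h1.comp continuous_projIcc
    have hyeq : ∀ t ∈ Icc (0 : ℝ) 1, y t = α (x, t) := by
      intro t ht; simp only [hydef]; rw [projIcc_of_mem _ ht]
    have hynorm : ∀ t, ‖y t‖ = 1 := fun t => hsph _ (projIcc 0 1 zero_le_one t).2
    set f : ℝ → ℝ := fun t => r * max (inner ℝ a (y t) - c) 0 with hf
    have hfc : Continuous f := by fun_prop
    set m : ℝ → ℝ := fun t => f t * inner ℝ (y t) w with hm
    have hmc : Continuous m := by fun_prop
    -- Integrating factor: on the unit sphere `α' = f (w - ⟪α, w⟫ α)`, hence `(A α)' = A f w`, which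
    -- always points along `w`.
    set A : ℝ → ℝ := fun t => Real.exp (∫ u in (0 : ℝ)..t, m u) with hA
    have hAd : ∀ t, HasDerivAt A (A t * m t) t := fun t =>
      (intervalIntegral.integral_hasDerivAt_right (hmc.intervalIntegrable _ _)
        (hmc.stronglyMeasurableAtFilter _ _) hmc.continuousAt).exp
    have hAc : Continuous A := continuous_iff_continuousAt.2 fun t => (hAd t).continuousAt
    set g : ℝ → ℝ := fun t => A t * f t with hg
    have hgc : Continuous g := hAc.mul hfc
    set s : ℝ → ℝ := fun t => ∫ u in (0 : ℝ)..t, g u with hs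
    have hsd : ∀ t, HasDerivAt s (g t) t := fun t =>
      intervalIntegral.integral_hasDerivAt_right (hgc.intervalIntegrable _ _)
        (hgc.stronglyMeasurableAtFilter _ _) hgc.continuousAt
    have hsc : Continuous s := continuous_iff_continuousAt.2 fun t => (hsd t).continuousAt
    have hconst := constant_of_has_deriv_right_zero (f := fun t => A t • α (x, t) - s t • w)
      (a := 0) (b := 1)
      ((hAc.continuousOn.smul hy).sub (hsc.continuousOn.smul continuousOn_const)) (fun t ht => by
        have h1 := (((hAd t).hasDerivWithinAt (s := Ici t)).smul (hder' t ht)).sub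
          (((hsd t).hasDerivWithinAt (s := Ici t)).smul_const w)
        have ht' := Ico_subset_Icc_self ht
        have hyt := hyeq t ht'
        have h2 : A t • capField r c a w (α (x, t)) + (A t * m t) • α (x, t) - g t • w = 0 := by
          simp only [capField, hg, hm, hf, hyt, hsph t ht']
          module
        rw [h2] at h1
        exact h1)
    have h1 := hconst 1 (by simp)
    have hA0 : A 0 = 1 := by simp [hA]
    have hs0 : s 0 = 0 := by simp [hs]
    simp only [hA0, hs0, h0, one_smul, zero_smul, sub_zero] at h1
    have hfnn : ∀ t, 0 ≤ f t := fun t => mul_nonneg hr.le (le_max_right _ _)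
    have hgnn : ∀ t, 0 ≤ g t := fun t => mul_nonneg (Real.exp_pos _).le (hfnn t)
    refine ⟨A 1, s 1, Real.exp_pos _, intervalIntegral.integral_nonneg zero_le_one
      fun t _ => hgnn t, sub_eq_iff_eq_add.1 h1, fun hc => ?_⟩
    refine intervalIntegral.integral_pos zero_lt_one hgc.continuousOn (fun t _ => hgnn t)
      ⟨0, by simp, ?_⟩
    refine mul_pos (Real.exp_pos _) (mul_pos hr (lt_max_of_lt_left ?_))
    rw [hyeq 0 (by simp), h0]; linarith
  · intro hc
    have := ODE_solution_unique_of_mem_Icc_right (v := fun _ => capField r c a w)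
      (s := fun _ => Metric.closedBall (0 : E d) 2) (K := K) (f := fun s => α (x, s))
      (g := fun _ => x) (a := 0) (b := 1) (fun t _ => hK) hy hder'
      (fun t ht => by
        have := hsph t (Ico_subset_Icc_self ht)
        simp [this]) continuousOn_const (fun t _ => ?_) (fun t _ => by simp [hx1])
      (by simpa using h0)
    · exact this (by simp : (1 : ℝ) ∈ Icc (0 : ℝ) 1)
    · have h2 : capField r c a w x = 0 := by
        simp [capField, max_eq_right (sub_nonpos.2 hc)]
      rw [h2]
      exact hasDerivWithinAt_const _ _ _

/-- The flow that moves the points of the cap `⟪a, x⟫ > c` towards `w`, and fixes the others. -/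
theorem exists_cap_flow (a : E d) (c : ℝ) (w : S d) :
    ∃ (W U : Matrix (Fin d) (Fin d) ℝ) (b : E d) (Φ : ℝ → S d → S d), IsFlow W U b Φ ∧
      (∀ x, Btw x (Φ 1 x) w) ∧ (∀ x : S d, inner ℝ a (x : E d) ≤ c → Φ 1 x = x) ∧
      ∀ x : S d, c < inner ℝ a (x : E d) → x ≠ w → (x : E d) ≠ -(w : E d) → Φ 1 x ≠ x := by
  obtain ⟨M, hM⟩ := (isCompact_closedBall (0 : E d) 2).exists_bound_of_continuousOn
    (locallyLipschitz_capField 1 c a (w : E d)).continuous.continuousOn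
  have hM0 : 0 ≤ M := (norm_nonneg _).trans (hM 0 (by simp))
  set r := (M + 1)⁻¹ with hr
  have hrpos : 0 < r := by positivity
  have hbound : ∀ x ∈ Metric.closedBall (0 : E d) 2, ‖capField r c a (w : E d) x‖ ≤ 1 := by
    intro x hx
    rw [capField_eq_smul, norm_smul, Real.norm_eq_abs, abs_of_pos hrpos, hr]
    rw [inv_mul_le_iff₀ (by positivity)]
    linarith [hM x hx]
  obtain ⟨α, hαc, hαi, hα⟩ := capField_flow r c hrpos a (w : E d) hbound
  obtain ⟨W, U, b, hv⟩ := exists_vel_eq_capField r c a w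
  have hclamp : ∀ t, ((projIcc 0 1 zero_le_one t : Icc (0 : ℝ) 1) : ℝ) ∈ Icc (0 : ℝ) 1 :=
    fun t => (projIcc 0 1 zero_le_one t).2
  set Φ : ℝ → S d → S d := fun t x =>
    ⟨α ((x : E d), (projIcc 0 1 zero_le_one t : ℝ)), (hα x x.2).2.1 _ (hclamp t)⟩ with hΦ
  have hΦeq : ∀ t ∈ Icc (0 : ℝ) 1, ∀ x, (Φ t x : E d) = α ((x : E d), t) := by
    intro t ht x; simp only [hΦ]; rw [projIcc_of_mem _ ht]
  have h1 : ∀ x, (Φ 1 x : E d) = α ((x : E d), 1) := hΦeq 1 (by simp)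
  refine ⟨W, U, b, Φ, ⟨?_, ?_, ?_, ?_, ?_⟩, ?_, ?_, ?_⟩
  · refine Continuous.subtype_mk ?_ _
    refine hαc.comp_continuous (f := fun p : ℝ × S d =>
      ((p.2 : E d), ((projIcc 0 1 zero_le_one p.1 : Icc (0 : ℝ) 1) : ℝ))) ?_ ?_
    · have : Continuous fun p : ℝ × S d => projIcc (0 : ℝ) 1 zero_le_one p.1 :=
        continuous_projIcc.comp continuous_fst
      fun_prop
    · intro p
      exact ⟨by simp, hclamp _⟩
  · intro t ht x
    apply Subtype.ext
    simp only [hΦ]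
    rw [projIcc_of_le_left _ ht]
    exact (hα x x.2).1
  · intro t ht x
    apply Subtype.ext
    rw [h1]
    simp only [hΦ]
    rw [projIcc_of_right_le _ ht]
  · intro x y hxy
    have h2 := congrArg (Subtype.val) hxy
    rw [h1, h1] at h2
    exact Subtype.ext (hαi x x.2 y y.2 h2)
  · intro x t ht
    rw [hv, hΦeq t (Ico_subset_Icc_self ht)]
    refine ((hα x x.2).2.2.1 t ht).congr_of_eventuallyEq ?_
      (hΦeq t (Ico_subset_Icc_self ht) x)
    filter_upwards [Icc_mem_nhdsGE_of_mem ht] with s hs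
    exact hΦeq s hs x
  · intro x
    obtain ⟨A, s, hA, hs, h, -⟩ := (hα x x.2).2.2.2.1
    refine btw_of_combination (α := A⁻¹) (β := A⁻¹ * s) (by positivity) (by positivity) ?_
    rw [h1, mul_smul, ← smul_add, ← h, smul_smul, inv_mul_cancel₀ hA.ne', one_smul]
  · intro x hx
    apply Subtype.ext
    rw [h1]
    exact (hα x x.2).2.2.2.2 hx
  · intro x hx hxw hxw' heq
    obtain ⟨A, s, hA, hs, h, hpos⟩ := (hα x x.2).2.2.2.1
    have hs := hpos hx
    rw [← h1, heq] at h
    have h3 : (A - 1) • (x : E d) = s • (w : E d) := by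
      rw [sub_smul, h]; simp
    have h4 : (w : E d) = (s⁻¹ * (A - 1)) • (x : E d) := by
      rw [mul_smul, h3, smul_smul, inv_mul_cancel₀ hs.ne', one_smul]
    have h5 := norm_coe_sphere w
    rw [h4, norm_smul, norm_coe_sphere, mul_one, Real.norm_eq_abs] at h5
    rcases (abs_eq zero_le_one).1 h5 with h6 | h6
    · rw [h6, one_smul] at h4; exact hxw (Subtype.ext h4.symm)
    · rw [h6, neg_smul, one_smul] at h4
      exact hxw' (by rw [h4, neg_neg])

/-! ### Realizable maps, and collapsing a compact set towards a point. -/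

/-- Finite compositions of time-one maps of layers. -/
inductive Realizable : (S d → S d) → Prop
  | id : Realizable (fun x => x)
  | step {W U : Matrix (Fin d) (Fin d) ℝ} {b : E d} {Φ : ℝ → S d → S d} {g : S d → S d} :
      IsFlow W U b Φ → Realizable g → Realizable (fun x => Φ 1 (g x))

lemma IsFlow.continuous_one {W U : Matrix (Fin d) (Fin d) ℝ} {b : E d} {Φ : ℝ → S d → S d}
    (h : IsFlow W U b Φ) : Continuous (Φ 1) := by
  have := h.continuous.comp (Continuous.prodMk_right (1 : ℝ))
  exact this

lemma Realizable.continuous {g : S d → S d} (hg : Realizable g) : Continuous g := by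
  induction hg with
  | id => exact continuous_id
  | step h _ ih => exact h.continuous_one.comp ih

lemma Realizable.injective {g : S d → S d} (hg : Realizable g) : Function.Injective g := by
  induction hg with
  | id => exact Function.injective_id
  | step h _ ih => exact h.injective.comp ih

lemma Realizable.comp {f g : S d → S d} (hf : Realizable f) (hg : Realizable g) :
    Realizable (fun x => f (g x)) := by
  induction hf with
  | id => exact hg
  | step h _ ih => exact Realizable.step h ih

lemma Realizable.iterate {g : S d → S d} (hg : Realizable g) (n : ℕ) : Realizable (g^[n]) := by
  induction n with
  | zero => exact Realizable.id
  | succ n ih => exact ih.comp hg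

lemma Btw.geodDist_lt {x z w : S d} (h : Btw x z w) (hne : z ≠ x) :
    geodDist z w < geodDist x w := by
  have := geodDist_pos hne.symm
  unfold Btw at h
  linarith

lemma Btw.geodDist_le {x z w : S d} (h : Btw x z w) : geodDist z w ≤ geodDist x w := by
  have := geodDist_nonneg x z
  unfold Btw at h
  linarith

lemma exists_cap_disjoint {F : Set (S d)} (hF : IsClosed F) {x : S d} (hx : x ∉ F) :
    ∃ c < (1 : ℝ), ∀ y ∈ F, inner ℝ (x : E d) (y : E d) ≤ c := by
  rcases F.eq_empty_or_nonempty with rfl | hne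
  · exact ⟨0, one_pos, by simp⟩
  obtain ⟨y, hy, hmax⟩ := hF.isCompact.exists_isMaxOn hne
    (f := fun y : S d => (inner ℝ (x : E d) (y : E d) : ℝ)) (by fun_prop)
  refine ⟨inner ℝ (x : E d) (y : E d), ?_, fun z hz => hmax hz⟩
  have h1 : (inner ℝ (x : E d) (y : E d) : ℝ) ≤ 1 := by
    have := real_inner_le_norm (x : E d) (y : E d)
    simpa using this
  refine lt_of_le_of_ne h1 fun h => hx ?_
  have := (inner_eq_one_iff_of_norm_eq_one (𝕜 := ℝ) (norm_coe_sphere x) (norm_coe_sphere y)).1 h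
  rwa [Subtype.ext this]

lemma exists_geodDist_ball_subset {O : Set (S d)} (hO : IsOpen O) {w : S d} (hw : w ∈ O) :
    ∃ ρ > 0, ∀ y, geodDist y w < ρ → y ∈ O := by
  rcases (Oᶜ).eq_empty_or_nonempty with h | hne
  · exact ⟨1, one_pos, fun y _ => by rw [compl_empty_iff] at h; simp [h]⟩
  obtain ⟨y, hy, hmin⟩ := hO.isClosed_compl.isCompact.exists_isMinOn hne
    (continuous_geodDist_right w).continuousOn
  refine ⟨geodDist y w, geodDist_pos ?_, fun z hz => ?_⟩
  · rintro rfl; exact hy hw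
  · by_contra h
    exact absurd (hmin h) (not_le.2 hz)

/-- A realizable map moving all points of `K` strictly towards `w` and fixing `F`. -/
lemma exists_contracting {w : S d} {K F : Set (S d)} (hK : IsClosed K)
    (hanti : ∀ x ∈ K, (x : E d) ≠ -(w : E d)) (hF : IsClosed F) (hKF : Disjoint K F) :
    ∃ g, Realizable g ∧ (∀ x, Btw x (g x) w) ∧ (∀ x ∈ F, g x = x) ∧
      ∀ x ∈ K, x ≠ w → g x ≠ x := by
  have hc : ∀ x : S d, ∃ c : ℝ, x ∈ K → c < 1 ∧ ∀ y ∈ F, inner ℝ (x : E d) (y : E d) ≤ c := by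
    intro x
    by_cases hx : x ∈ K
    · obtain ⟨c, h1, h2⟩ := exists_cap_disjoint hF (disjoint_left.1 hKF hx)
      exact ⟨c, fun _ => ⟨h1, h2⟩⟩
    · exact ⟨0, fun h => absurd h hx⟩
  choose c hc using hc
  set V : S d → Set (S d) := fun x => {y | c x < inner ℝ (x : E d) (y : E d)} with hV
  have hVo : ∀ x, IsOpen (V x) := fun x => isOpen_lt continuous_const (by fun_prop)
  obtain ⟨t, htK, hcov⟩ := hK.isCompact.elim_nhds_subcover V fun x hx =>
    (hVo x).mem_nhds (by simp only [hV, mem_ofPred_eq, inner_self_sphere]; exact (hc x hx).1)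
  -- One cap flow for each cap of the finite cover. The caps avoid `F`, so `F` stays fixed.
  have key : ∀ s : Finset (S d), (∀ x ∈ s, x ∈ K) → ∃ g, Realizable g ∧ (∀ x, Btw x (g x) w) ∧
      (∀ x ∈ F, g x = x) ∧
      ∀ x ∈ s, ∀ y ∈ V x, y ≠ w → (y : E d) ≠ -(w : E d) → g y ≠ y := by
    intro s
    classical
    induction s using Finset.induction_on with
    | empty => exact fun _ => ⟨_, Realizable.id, fun x => btw_left _ _, fun _ _ => rfl, by simp⟩
    | insert a s ha ih =>
      intro hs
      obtain ⟨g, hg, hgb, hgF, hgs⟩ := ih fun x hx => hs x (Finset.mem_insert_of_mem hx)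
      obtain ⟨W, U, b, Φ, hΦ, hΦb, hΦid, hΦne⟩ := exists_cap_flow (a : E d) (c a) w
      refine ⟨_, hg.step hΦ, fun x => (hgb x).trans (hΦb _), fun x hx => ?_, fun x hx y hy hyw hyw' => ?_⟩
      · rw [hgF x hx]
        exact hΦid x ((hc a (hs a (Finset.mem_insert_self _ _))).2 x hx)
      -- Later flows cannot undo a displacement: the distance to `w` never increases, and it drops
      -- strictly whenever a point moves.
      · by_cases hgy : g y = y
        · rw [hgy]
          rcases Finset.mem_insert.1 hx with rfl | hx
          · exact hΦne y hy hyw hyw'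
          · exact absurd hgy (hgs x hx y hy hyw hyw')
        · intro h
          have h1 := (hgb y).geodDist_lt hgy
          have h2 := (hΦb (g y)).geodDist_le
          rw [h] at h2
          linarith
  obtain ⟨g, hg, hgb, hgF, hgt⟩ := key t htK
  refine ⟨g, hg, hgb, hgF, fun x hx hxw => ?_⟩
  have := hcov hx
  simp only [mem_iUnion] at this
  obtain ⟨a, ha, hxa⟩ := this
  exact hgt a ha x hxa hxw (hanti x hx)

/-- A realizable map collapsing a compact set, star-shaped about `w`, into a neighbourhood of `w`,
that fixes a given closed set `F`. -/
theorem exists_collapse {w : S d} {K F O : Set (S d)} (hK : IsClosed K)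
    (hstar : ∀ x ∈ K, ∀ z, Btw x z w → z ∈ K) (hanti : ∀ x ∈ K, (x : E d) ≠ -(w : E d))
    (hF : IsClosed F) (hKF : Disjoint K F) (hO : IsOpen O) (hw : w ∈ O) :
    ∃ g, Realizable g ∧ (∀ x, Btw x (g x) w) ∧ (∀ x ∈ F, g x = x) ∧ ∀ x ∈ K, g x ∈ O := by
  obtain ⟨g, hg, hgb, hgF, hgK⟩ := exists_contracting hK hanti hF hKF
  obtain ⟨ρ, hρ, hρO⟩ := exists_geodDist_ball_subset hO hw
  -- The decrease of the distance is continuous and positive on the compact part of `K` outside the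
  -- `ρ`-ball, hence bounded below there. Star-shapedness keeps the iterates in `K`, so distances at
  -- most `π` are exhausted after more than `π / δ` iterations.
  have hδ : ∃ δ > 0, ∀ x ∈ K, ρ ≤ geodDist x w → geodDist (g x) w ≤ geodDist x w - δ := by
    rcases (K ∩ {x | ρ ≤ geodDist x w}).eq_empty_or_nonempty with h | hne
    · refine ⟨1, one_pos, fun x hx hx' => ?_⟩
      exact absurd (show x ∈ K ∩ {x | ρ ≤ geodDist x w} from ⟨hx, hx'⟩) (by simp [h])
    · have hcl : IsClosed (K ∩ {x | ρ ≤ geodDist x w}) :=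
        hK.inter (isClosed_le continuous_const (continuous_geodDist_right w))
      have hcont : Continuous fun x => geodDist x w - geodDist (g x) w :=
        (continuous_geodDist_right w).sub ((continuous_geodDist_right w).comp hg.continuous)
      obtain ⟨y, hy, hmin⟩ := hcl.isCompact.exists_isMinOn hne hcont.continuousOn
      refine ⟨geodDist y w - geodDist (g y) w, ?_, fun x hx hx' => ?_⟩
      · have hyw : y ≠ w := by
          rintro rfl
          have := hy.2
          simp only [mem_ofPred_eq, geodDist_self] at this
          linarith
        have := (hgb y).geodDist_lt (hgK y hy.1 hyw)
        linarith
      · have : geodDist y w - geodDist (g y) w ≤ geodDist x w - geodDist (g x) w := hmin ⟨hx, hx'⟩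
        linarith
  obtain ⟨δ, hδ, hdec⟩ := hδ
  have hiter : ∀ n : ℕ, ∀ x, Btw x (g^[n] x) w := by
    intro n
    induction n with
    | zero => exact fun x => btw_left _ _
    | succ n ih =>
      intro x
      rw [Function.iterate_succ_apply']
      exact (ih x).trans (hgb _)
  have hdist : ∀ n : ℕ, ∀ x ∈ K, geodDist (g^[n] x) w < ρ ∨
      geodDist (g^[n] x) w ≤ geodDist x w - n * δ := by
    intro n
    induction n with
    | zero => intro x _; right; simp
    | succ n ih =>
      intro x hx
      rw [Function.iterate_succ_apply']
      by_cases h : geodDist (g^[n] x) w < ρ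
      · left; exact (hgb _).geodDist_le.trans_lt h
      · right
        have h1 := (ih x hx).resolve_left h
        have h2 := hdec _ (hstar x hx _ (hiter n x)) (not_lt.1 h)
        push_cast
        linarith
  obtain ⟨n, hn⟩ := exists_nat_gt (Real.pi / δ)
  refine ⟨g^[n], hg.iterate n, hiter n, fun x hx => Function.iterate_fixed (hgF x hx) n,
    fun x hx => hρO _ ?_⟩
  rcases hdist n x hx with h | h
  · exact h
  · exfalso
    rw [div_lt_iff₀ hδ] at hn
    linarith [geodDist_le_pi x w, geodDist_nonneg (g^[n] x) w]

/-! ### Cutting an atomless measure into slices that can be transported. -/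

lemma tendsto_real_of_monotone {X : Type*} [MeasurableSpace X] (μ : Measure X) [IsFiniteMeasure μ]
    {s : ℕ → Set X} (hs : Monotone s) :
    Tendsto (fun n => μ.real (s n)) atTop (𝓝 (μ.real (⋃ n, s n))) :=
  (ENNReal.tendsto_toReal (measure_ne_top _ _)).comp (tendsto_measure_iUnion_atTop hs)

lemma tendsto_real_of_antitone {X : Type*} [MeasurableSpace X] (μ : Measure X) [IsFiniteMeasure μ]
    {s : ℕ → Set X} (hs : Antitone s) (hm : ∀ n, MeasurableSet (s n)) :
    Tendsto (fun n => μ.real (s n)) atTop (𝓝 (μ.real (⋂ n, s n))) :=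
  (ENNReal.tendsto_toReal (measure_ne_top _ _)).comp
    (tendsto_measure_iInter_atTop (fun n => (hm n).nullMeasurableSet) hs ⟨0, measure_ne_top _ _⟩)

/-- An atomless finite measure on the line can be cut, up to a small loss, into a right part of
prescribed mass and a left part, separated by a gap. -/
lemma exists_cut (lam : Measure ℝ) [IsFiniteMeasure lam] [NullSingletonClass lam] {β η : ℝ} (hβ : 0 < β)
    (hη : 0 < η) : ∃ c c' : ℝ, c < c' ∧ lam.real (Ici c') ≤ β ∧
      min β (lam.real univ) - η ≤ lam.real (Ici c') ∧
      lam.real univ - η ≤ lam.real (Ici c') + lam.real (Iic c) := by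
  have hbot : Tendsto (fun n : ℕ => lam.real (Ici (-(n : ℝ)))) atTop (𝓝 (lam.real univ)) := by
    have : (⋃ n : ℕ, Ici (-(n : ℝ))) = univ := by
      refine eq_univ_of_forall fun x => mem_iUnion.2 ?_
      obtain ⟨n, hn⟩ := exists_nat_ge (-x)
      exact ⟨n, by simp only [mem_Ici]; linarith⟩
    rw [← this]
    refine tendsto_real_of_monotone lam fun m n h => Ici_subset_Ici.2 ?_
    have : (m : ℝ) ≤ n := by exact_mod_cast h
    linarith
  have htop : Tendsto (fun n : ℕ => lam.real (Ici (n : ℝ))) atTop (𝓝 0) := by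
    have : (⋂ n : ℕ, Ici (n : ℝ)) = ∅ := by
      refine eq_empty_of_forall_notMem fun x hx => ?_
      obtain ⟨n, hn⟩ := exists_nat_gt x
      exact absurd (mem_iInter.1 hx n) (not_le.2 hn)
    have h := tendsto_real_of_antitone lam (s := fun n : ℕ => Ici (n : ℝ))
      (fun m n h => Ici_subset_Ici.2 (by exact_mod_cast h)) fun n => measurableSet_Ici
    rwa [this, measureReal_empty] at h
  have hanti : ∀ a b : ℝ, a ≤ b → lam.real (Ici b) ≤ lam.real (Ici a) := fun a b h =>
    measureReal_mono (Ici_subset_Ici.2 h)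
  -- If `β` is at least the total mass, the right part takes almost everything.
  rcases le_or_gt (lam.real univ) β with hle | hlt
  · obtain ⟨n, hn⟩ := (hbot.eventually (lt_mem_nhds (show lam.real univ - η < lam.real univ by
      linarith))).exists
    refine ⟨-(n : ℝ) - 1, -(n : ℝ), by linarith, (measureReal_mono (subset_univ _)).trans hle,
      by rw [min_eq_right hle]; exact hn.le, ?_⟩
    have : 0 ≤ lam.real (Iic (-(n : ℝ) - 1)) := measureReal_nonneg
    linarith
  -- Otherwise cut at the infimum `c` of the admissible thresholds. Then `Ici c` has mass at least
  -- `β`, `Ioi c` has the same mass since there are no atoms, and a threshold slightly above `c`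
  -- opens the gap at a cost below `η`.
  set T : Set ℝ := {c | lam.real (Ici c) ≤ β} with hT
  have hTne : T.Nonempty := by
    obtain ⟨n, hn⟩ := (htop.eventually (gt_mem_nhds hβ)).exists
    exact ⟨n, hn.le⟩
  have hTbdd : BddBelow T := by
    obtain ⟨n, hn⟩ := (hbot.eventually (lt_mem_nhds hlt)).exists
    refine ⟨-(n : ℝ), fun c hc => ?_⟩
    by_contra h
    have h1 : lam.real (Ici c) ≤ β := hc
    have := hanti c (-(n : ℝ)) (not_le.1 h).le
    linarith
  set c := sInf T with hc
  have hgt : ∀ c' > c, lam.real (Ici c') ≤ β := by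
    intro c' hc'
    obtain ⟨t, ht, htc⟩ := exists_lt_of_csInf_lt hTne hc'
    exact (hanti _ _ htc.le).trans ht
  have hlt' : ∀ c' < c, β < lam.real (Ici c') := by
    intro c' hc'
    by_contra h
    exact absurd (csInf_le hTbdd (show c' ∈ T from not_lt.1 h)) (not_le.2 hc')
  have hone : ∀ m n : ℕ, m ≤ n → 1 / ((n : ℝ) + 1) ≤ 1 / ((m : ℝ) + 1) := fun m n h =>
    Nat.one_div_le_one_div h
  have hIci : β ≤ lam.real (Ici c) := by
    have : (⋂ n : ℕ, Ici (c - 1 / ((n : ℝ) + 1))) = Ici c := by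
      ext x
      simp only [mem_iInter, mem_Ici]
      constructor
      · intro h
        refine le_of_forall_pos_le_add fun e he => ?_
        obtain ⟨n, hn⟩ := exists_nat_one_div_lt he
        linarith [h n]
      · intro h n
        have : 0 < 1 / ((n : ℝ) + 1) := Nat.one_div_pos_of_nat
        linarith
    have h := tendsto_real_of_antitone lam (s := fun n : ℕ => Ici (c - 1 / ((n : ℝ) + 1)))
      (fun m n h => Ici_subset_Ici.2 (by linarith [hone m n h])) fun n => measurableSet_Ici
    rw [this] at h
    refine ge_of_tendsto' h fun n => (hlt' _ ?_).le
    have : 0 < 1 / ((n : ℝ) + 1) := Nat.one_div_pos_of_nat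
    linarith
  have hIoi : lam.real (Ioi c) = lam.real (Ici c) := measureReal_congr Ioi_ae_eq_Ici
  have hlim : Tendsto (fun n : ℕ => lam.real (Ici (c + 1 / ((n : ℝ) + 1)))) atTop
      (𝓝 (lam.real (Ioi c))) := by
    have : (⋃ n : ℕ, Ici (c + 1 / ((n : ℝ) + 1))) = Ioi c := by
      ext x
      simp only [mem_iUnion, mem_Ici, mem_Ioi]
      constructor
      · rintro ⟨n, hn⟩
        have : 0 < 1 / ((n : ℝ) + 1) := Nat.one_div_pos_of_nat
        linarith
      · intro h
        obtain ⟨n, hn⟩ := exists_nat_one_div_lt (sub_pos.2 h)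
        exact ⟨n, by linarith⟩
    rw [← this]
    exact tendsto_real_of_monotone lam fun m n h => Ici_subset_Ici.2 (by linarith [hone m n h])
  obtain ⟨n, hn⟩ := (hlim.eventually (lt_mem_nhds (show lam.real (Ioi c) - η < lam.real (Ioi c) by
    linarith))).exists
  have hpos : 0 < 1 / ((n : ℝ) + 1) := Nat.one_div_pos_of_nat
  refine ⟨c, c + 1 / ((n : ℝ) + 1), by linarith, hgt _ (by linarith), ?_, ?_⟩
  · have := min_le_left β (lam.real univ)
    linarith
  · have : lam.real (Iic c) + lam.real (Ioi c) = lam.real univ := by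
      rw [← compl_Iic]
      exact measureReal_add_measureReal_compl measurableSet_Iic
    linarith

/-- A hyperplane is Lebesgue-null. Applied to differences of points, this says that a generic linear
form separates a given pair. -/
lemma volume_inner_eq_zero {z : E d} (hz : z ≠ 0) : ∀ᵐ u : E d, inner ℝ u z ≠ (0 : ℝ) := by
  rw [ae_iff]
  have h := Measure.addHaar_submodule (volume : Measure (E d)) (LinearMap.ker (innerₛₗ ℝ z)) (by
    intro h
    have : z ∈ LinearMap.ker (innerₛₗ ℝ z) := by rw [h]; trivial
    simp at this
    exact hz this)
  refine measure_mono_null (fun u hu => ?_) h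
  simp only [SetLike.mem_coe, LinearMap.mem_ker]
  simpa [real_inner_comm] using hu

/-- The central projection from the half sphere `⟪v, x⟫ > 0` to an affine hyperplane. -/
noncomputable def centralProj (v : E d) (x : S d) : E d := (inner ℝ v (x : E d) : ℝ)⁻¹ • (x : E d)

lemma centralProj_injOn (v : E d) {x y : S d} (hx : 0 < (inner ℝ v (x : E d) : ℝ))
    (hy : 0 < (inner ℝ v (y : E d) : ℝ)) (h : centralProj v x = centralProj v y) : x = y := by
  unfold centralProj at h
  refine sphere_eq_of_smul (r := (inner ℝ v (x : E d) : ℝ) * (inner ℝ v (y : E d) : ℝ)⁻¹)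
    (by positivity) ?_
  rw [mul_smul, ← h, smul_smul, mul_inv_cancel₀ hx.ne', one_smul]

lemma measurable_centralProj (v : E d) : Measurable (centralProj v) := by
  unfold centralProj
  have h1 : Measurable fun x : S d => (inner ℝ v (x : E d) : ℝ) :=
    Continuous.measurable (by fun_prop)
  exact h1.inv.smul measurable_subtype_coe

/-- For a generic linear form `u`, the level sets of `⟪u, x⟫ / ⟪v, x⟫` are null for a given
atomless measure on the half sphere `⟪v, x⟫ > 0`. -/
lemma ae_noAtoms_map_centralProj (ν : Measure (S d)) [IsFiniteMeasure ν] (hν : ∀ y, ν {y} = 0)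
    (v : E d) (hv : ∀ᵐ x : S d ∂ν, 0 < (inner ℝ v (x : E d) : ℝ)) :
    ∀ᵐ u : E d, NullSingletonClass (ν.map fun x => (inner ℝ u (centralProj v x) : ℝ)) := by
  have : NullSingletonClass ν := ⟨hν⟩
  have hm : Measurable (centralProj v) := measurable_centralProj v
  -- The diagonal is `ν × ν`-null because `ν` has no atoms, and the central projection is injective
  -- on the half sphere. Exchanging the quantifiers by Fubini, almost every `u` separates almost
  -- every pair.
  have h1 : ∀ᵐ z ∂(ν.prod ν), ∀ᵐ u : E d,
      (inner ℝ u (centralProj v z.1 - centralProj v z.2) : ℝ) ≠ 0 := by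
    have h2 : ∀ᵐ z ∂(ν.prod ν), z.1 ≠ z.2 := by
      rw [ae_iff]
      have hd : MeasurableSet {z : S d × S d | ¬ z.1 ≠ z.2} := by
        simp only [not_not]
        exact (isClosed_eq continuous_fst continuous_snd).measurableSet
      rw [Measure.measure_prod_null hd]
      refine Eventually.of_forall fun x => ?_
      have : (Prod.mk x ⁻¹' {z : S d × S d | ¬ z.1 ≠ z.2}) = {x} := by
        ext y; simp [eq_comm]
      simp only [this, Pi.zero_apply]; exact hν x
    have h3 : ∀ᵐ z ∂(ν.prod ν), 0 < (inner ℝ v (z.1 : E d) : ℝ) :=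
      Measure.quasiMeasurePreserving_fst.ae hv
    have h4 : ∀ᵐ z ∂(ν.prod ν), 0 < (inner ℝ v (z.2 : E d) : ℝ) :=
      Measure.quasiMeasurePreserving_snd.ae hv
    filter_upwards [h2, h3, h4] with z hz h3 h4
    exact volume_inner_eq_zero (sub_ne_zero.2 fun h => hz (centralProj_injOn v h3 h4 h))
  have hmeas : MeasurableSet {q : (S d × S d) × E d |
      (inner ℝ q.2 (centralProj v q.1.1 - centralProj v q.1.2) : ℝ) ≠ 0} := by
    have : Measurable fun q : (S d × S d) × E d =>
        (inner ℝ q.2 (centralProj v q.1.1 - centralProj v q.1.2) : ℝ) := by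
      fun_prop
    exact (this (measurableSet_singleton 0)).compl
  rw [Measure.ae_ae_comm (p := fun (z : S d × S d) (u : E d) =>
    (inner ℝ u (centralProj v z.1 - centralProj v z.2) : ℝ) ≠ 0) hmeas] at h1
  filter_upwards [h1] with u hu
  have hh : Measurable fun x => (inner ℝ u (centralProj v x) : ℝ) := by fun_prop
  refine ⟨fun c => ?_⟩
  rw [Measure.map_apply hh (measurableSet_singleton c)]
  -- A level set of positive mass would contain a point `x` whose value differs from that of almost
  -- every point, yet agrees with it on the whole level set.
  by_contra hne
  have hxy := Measure.ae_ae_of_ae_prod hu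
  have hfr : ∃ᶠ x in ae ν, x ∈ (fun x => (inner ℝ u (centralProj v x) : ℝ)) ⁻¹' {c} := by
    rw [frequently_ae_mem_iff]; exact hne
  obtain ⟨x, hx, hxy⟩ := (hfr.and_eventually hxy).exists
  rw [ae_iff] at hxy
  refine hne (measure_mono_null (fun y hy => ?_) hxy)
  simp only [mem_preimage, mem_singleton_iff] at hx hy
  simp [inner_sub_right, hx, hy]

/-- A compact part `R` of the half sphere `⟪v, x⟫ > 0`, `v ⊥ w`, contains a closed piece `L` of
nearly prescribed mass which can be moved along geodesics to `w` without meeting the rest. -/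
theorem exists_slice (ν : Measure (S d)) [IsFiniteMeasure ν] (hν : ∀ y, ν {y} = 0) {w : S d}
    {v : E d} (hvw : inner ℝ v (w : E d) = (0 : ℝ)) {R : Set (S d)} (hR : IsClosed R)
    (hRv : ∀ x ∈ R, 0 < (inner ℝ v (x : E d) : ℝ)) {β η : ℝ} (hβ : 0 ≤ β) (hη : 0 < η) :
    ∃ L R' : Set (S d), IsClosed L ∧ IsClosed R' ∧ L ⊆ R ∧ R' ⊆ R ∧ Disjoint (starHull w L) R' ∧
      ν.real L ≤ β ∧ min β (ν.real R) - η ≤ ν.real L ∧ ν.real R - η ≤ ν.real L + ν.real R' := by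
  rcases hβ.eq_or_lt with rfl | hβ
  · refine ⟨∅, R, isClosed_empty, hR, empty_subset _, subset_rfl, ?_, by simp, ?_, ?_⟩
    · simp [starHull]
    · rw [min_eq_left measureReal_nonneg]; simp [hη.le]
    · simp [hη.le]
  have hνR : ∀ y, (ν.restrict R) {y} = 0 := fun y => by
    rw [← nonpos_iff_eq_zero, ← hν y]; exact Measure.restrict_apply_le _ _
  have hRae : ∀ᵐ x : S d ∂(ν.restrict R), 0 < (inner ℝ v (x : E d) : ℝ) := by
    filter_upwards [ae_restrict_mem hR.measurableSet] with x hx using hRv x hx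
  have hopen : IsOpen {u : E d | 0 < (inner ℝ u (w : E d) : ℝ)} :=
    isOpen_lt continuous_const (by fun_prop)
  -- Generic forms are dense, and `⟪u, w⟫ > 0` is a nonempty open condition, so both can be met.
  obtain ⟨u, huw, hu⟩ := (Measure.dense_of_ae
    (ae_noAtoms_map_centralProj (ν.restrict R) hνR v hRae)).exists_mem_open hopen
      ⟨(w : E d), by simp⟩
  set h : S d → ℝ := fun x => (inner ℝ u (centralProj v x) : ℝ) with hh
  have hm : Measurable h := by
    have : Measurable (centralProj v) := measurable_centralProj v
    fun_prop
  have hcont : ContinuousOn h R := by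
    have h1 : ContinuousOn (fun x : S d => (inner ℝ v (x : E d) : ℝ)) R :=
      Continuous.continuousOn (by fun_prop)
    have h2 : ContinuousOn (centralProj v) R :=
      (h1.inv₀ fun x hx => (hRv x hx).ne').smul continuous_subtype_val.continuousOn
    exact continuousOn_const.inner h2
  have hna : NullSingletonClass ((ν.restrict R).map h) := huw
  obtain ⟨c, c', hcc', h1, h2, h3⟩ := exists_cut ((ν.restrict R).map h) hβ hη
  have hreal : ∀ s : Set ℝ, MeasurableSet s →
      ((ν.restrict R).map h).real s = ν.real (R ∩ h ⁻¹' s) := by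
    intro s hs
    rw [map_measureReal_apply hm hs, measureReal_restrict_apply (hm hs), inter_comm]
  rw [hreal _ measurableSet_Ici, hreal _ MeasurableSet.univ, preimage_univ, inter_univ] at h2
  rw [hreal _ measurableSet_Ici, hreal _ measurableSet_Iic, hreal _ MeasurableSet.univ,
    preimage_univ, inter_univ] at h3
  rw [hreal _ measurableSet_Ici] at h1
  refine ⟨R ∩ h ⁻¹' Ici c', R ∩ h ⁻¹' Iic c, hcont.preimage_isClosed_of_isClosed hR isClosed_Ici,
    hcont.preimage_isClosed_of_isClosed hR isClosed_Iic, inter_subset_left, inter_subset_left,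
    ?_, h1, h2, h3⟩
  rw [disjoint_left]
  rintro z ⟨y, ⟨hyR, hyc⟩, hb⟩ ⟨hzR, hzc⟩
  simp only [mem_preimage, mem_Ici, mem_Iic] at hyc hzc
  have hvy := hRv y hyR
  have hvz := hRv z hzR
  have hne : (w : E d) ≠ -(y : E d) := by
    intro hw
    rw [hw, inner_neg_right] at hvw
    linarith
  obtain ⟨a, b, ha, hb', hz⟩ := hb.exists_combination hne
  have hvz' : (inner ℝ v (z : E d) : ℝ) = a * inner ℝ v (y : E d) := by
    rw [hz, inner_add_right, inner_smul_right, inner_smul_right, hvw]; ring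
  have hapos : 0 < a := by
    rcases ha.eq_or_lt with rfl | ha
    · rw [hvz'] at hvz; simp at hvz
    · exact ha
  have huz : (inner ℝ u (z : E d) : ℝ) = a * inner ℝ u (y : E d) + b * inner ℝ u (w : E d) := by
    rw [hz, inner_add_right, inner_smul_right, inner_smul_right]
  -- The ratio `⟪u, ·⟫ / ⟪v, ·⟫` increases towards `w`: for `z = a y + b w` its denominator is `a
  -- ⟪v, y⟫`, as `v ⊥ w`, while its numerator gains `b ⟪u, w⟫ ≥ 0`. Moving a superlevel set to `w`
  -- therefore never meets the lower part.
  have hle : h y ≤ h z := by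
    simp only [hh, centralProj, inner_smul_right]
    rw [hvz', huz, mul_inv, mul_comm (a⁻¹), mul_assoc]
    refine mul_le_mul_of_nonneg_left ?_ (by positivity)
    rw [mul_add, ← mul_assoc, inv_mul_cancel₀ hapos.ne', one_mul]
    have : 0 ≤ a⁻¹ * (b * inner ℝ u (w : E d)) := by
      have : 0 < (inner ℝ u (w : E d) : ℝ) := by simpa using hu
      positivity
    linarith
  linarith

/-! ### Steering an atomless measure to a discrete one. -/

/-- Distribution of a blob `Q` among targets `x k`, `k ∈ s`, the farthest ones from `p` first. -/
theorem exists_distribution {ι : Type*} [DecidableEq ι] (ν : Measure (S d)) [IsFiniteMeasure ν]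
    (hν : ∀ y, ν {y} = 0) {C Q : Set (S d)} (hC : GeodConvex C) {p : S d}
    {x : ι → S d} (hxC : ∀ k, x k ∈ C) {v : ι → E d}
    (hvx : ∀ k, inner ℝ (v k) (x k : E d) = (0 : ℝ))
    (hvQ : ∀ k, ∀ z ∈ Q, 0 < (inner ℝ (v k) (z : E d) : ℝ)) {ρ : ℝ} (hρ : 0 < ρ)
    (hsep : ∀ j k, j ≠ k → geodDist p (x k) ≤ geodDist p (x j) →
      Disjoint (starHull (x k) Q) {y | geodDist y (x j) ≤ ρ})
    {α : ι → ℝ} (hα : ∀ k, 0 ≤ α k) {η : ℝ} (hη : 0 < η) (n : ℕ) :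
    ∀ (s : Finset ι), s.card = n → ∀ R F : Set (S d), IsClosed R → R ⊆ Q → IsClosed F →
      (∀ k ∈ s, Disjoint (starHull (x k) Q) F) →
      ∃ g, Realizable g ∧ (∀ z ∈ F, g z = z) ∧ (∀ z ∈ C, g z ∈ C) ∧ ∃ L : ι → Set (S d),
        (∀ k ∈ s, IsClosed (L k) ∧ L k ⊆ R ∧ (∀ z ∈ L k, geodDist (g z) (x k) ≤ ρ) ∧
          ν.real (L k) ≤ α k) ∧ (∀ j ∈ s, ∀ k ∈ s, j ≠ k → Disjoint (L j) (L k)) ∧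
        min (∑ k ∈ s, α k) (ν.real R) - n * η ≤ ∑ k ∈ s, ν.real (L k) := by
  induction n with
  | zero =>
    intro s hs R F _ _ _ _
    rw [Finset.card_eq_zero] at hs
    subst hs
    refine ⟨_, Realizable.id, fun _ _ => rfl, fun _ h => h, fun _ => ∅, by simp, by simp, ?_⟩
    simp
  | succ n ih =>
    intro s hs R F hR hRQ hF hdis
    have hne : s.Nonempty := Finset.card_pos.1 (by omega)
    -- Serving the farthest target first lets `hsep` apply: the routes to the nearer targets avoid
    -- the ball where this slice is parked.
    obtain ⟨k, hk, hkmax⟩ := s.exists_max_image (fun k => geodDist p (x k)) hne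
    obtain ⟨L, R', hL, hR', hLR, hR'R, hLR', hLα, hLge, hRest⟩ := exists_slice ν hν (hvx k) hR
      (fun z hz => hvQ k z (hRQ hz)) (hα k) hη
    have hhull : starHull (x k) L ⊆ starHull (x k) Q := by
      rintro z ⟨y, hy, h⟩; exact ⟨y, hRQ (hLR hy), h⟩
    obtain ⟨g, hg, hgb, hgF, hgL⟩ := exists_collapse (w := x k) (K := starHull (x k) L)
      (F := F ∪ R') (O := {y | geodDist y (x k) < ρ}) (isCompact_starHull (x k) hL).isClosed
      (fun y hy z hz => starHull_btw hy hz)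
      -- A point of the star antipodal to `x k` would force its starting point in `L` to be
      -- antipodal too, hence orthogonal to `v k`, against `hvQ`.
      (by
        rintro z ⟨y, hy, h⟩ hz
        have h1 := h.geodDist_le
        rw [geodDist_eq_pi_iff.2 (by rw [hz, neg_neg])] at h1
        have h2 := geodDist_eq_pi_iff.1 (le_antisymm (geodDist_le_pi _ _) h1)
        have h3 := hvx k
        rw [h2, inner_neg_right] at h3
        have h4 := hvQ k y (hRQ (hLR hy))
        linarith)
      (hF.union hR') (disjoint_union_right.2 ⟨(hdis k hk).mono_left hhull, hLR'⟩)
      (isOpen_lt (continuous_geodDist_right _) continuous_const)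
      (by simpa [geodDist_self] using hρ)
    have hcard : (s.erase k).card = n := by rw [Finset.card_erase_of_mem hk]; omega
    -- The ball around the target just served joins the fixed set for the remaining moves.
    obtain ⟨g', hg', hg'F, hg'C, L', hL', hL'dis, hL'ge⟩ := ih (s.erase k) hcard R'
      (F ∪ {y | geodDist y (x k) ≤ ρ}) hR' (hR'R.trans hRQ)
      (hF.union (isClosed_le (continuous_geodDist_right _) continuous_const)) (by
        intro j hj
        obtain ⟨hjk, hj⟩ := Finset.mem_erase.1 hj
        exact disjoint_union_right.2 ⟨hdis j hj, hsep k j hjk.symm (hkmax j hj)⟩)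
    have hsub : ∀ j ∈ s, j ≠ k → L' j ⊆ R' := fun j hj hjk =>
      (hL' j (Finset.mem_erase.2 ⟨hjk, hj⟩)).2.1
    have hLdis : ∀ j ∈ s, j ≠ k → Disjoint L (L' j) := fun j hj hjk =>
      hLR'.mono (subset_starHull _ _) (hsub j hj hjk)
    refine ⟨_, hg'.comp hg, fun z hz => ?_, fun z hz => ?_, Function.update L' k L, ?_, ?_, ?_⟩
    · rw [hgF z (Or.inl hz), hg'F z (Or.inl hz)]
    · exact hg'C _ (hC z hz _ (hxC k) _ (hgb z))
    · intro j hj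
      rcases eq_or_ne j k with rfl | hjk
      · rw [Function.update_self]
        refine ⟨hL, hLR, fun z hz => ?_, hLα⟩
        have h1 : geodDist (g z) (x j) < ρ := hgL z (subset_starHull _ _ hz)
        rw [hg'F (g z) (Or.inr h1.le)]
        exact h1.le
      · rw [Function.update_of_ne hjk]
        obtain ⟨h1, h2, h3, h4⟩ := hL' j (Finset.mem_erase.2 ⟨hjk, hj⟩)
        refine ⟨h1, h2.trans hR'R, fun z hz => ?_, h4⟩
        rw [hgF z (Or.inr (h2 hz))]
        exact h3 z hz
    · intro i hi j hj hij
      rcases eq_or_ne i k with rfl | hik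
      · rw [Function.update_self, Function.update_of_ne hij.symm]
        exact hLdis j hj hij.symm
      · rw [Function.update_of_ne hik]
        rcases eq_or_ne j k with rfl | hjk
        · rw [Function.update_self]
          exact (hLdis i hi hik).symm
        · rw [Function.update_of_ne hjk]
          exact hL'dis i (Finset.mem_erase.2 ⟨hik, hi⟩) j (Finset.mem_erase.2 ⟨hjk, hj⟩) hij
    · rw [← Finset.add_sum_erase s _ hk, ← Finset.add_sum_erase s _ hk, Function.update_self]
      have h5 : ∑ j ∈ s.erase k, ν.real (Function.update L' k L j) =
          ∑ j ∈ s.erase k, ν.real (L' j) := Finset.sum_congr rfl fun j hj => by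
        rw [Function.update_of_ne (Finset.ne_of_mem_erase hj)]
      rw [h5]
      have h6 : 0 ≤ ∑ j ∈ s.erase k, α j := Finset.sum_nonneg fun j _ => hα j
      push_cast
      rcases min_cases (α k) (ν.real R) with ⟨e1, e2⟩ | ⟨e1, e2⟩ <;>
      rcases min_cases (∑ j ∈ s.erase k, α j) (ν.real R') with ⟨e3, e4⟩ | ⟨e3, e4⟩ <;>
      rcases min_cases (α k + ∑ j ∈ s.erase k, α j) (ν.real R) with ⟨e5, e6⟩ | ⟨e5, e6⟩ <;>
      rw [e1] at hLge <;> rw [e3] at hL'ge <;> rw [e5] <;> linarith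

lemma lintegral_sq_geodDist_le {π : Measure (S d × S d)} :
    ∫⁻ q, ENNReal.ofReal (geodDist q.1 q.2 ^ 2) ∂π ≤ ENNReal.ofReal (Real.pi ^ 2) * π univ := by
  rw [← lintegral_const]
  refine lintegral_mono fun q => ENNReal.ofReal_le_ofReal ?_
  exact pow_le_pow_left₀ (geodDist_nonneg _ _) (geodDist_le_pi _ _) 2

/-- If most of the mass of `μ` is sent by `Ψ` close to the right targets, then `Ψ_# μ` is close to
the discrete target measure. -/
lemma wasserstein2_le {ι : Type*} [Fintype ι] (μ : Measure (S d)) [IsProbabilityMeasure μ]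
    {Ψ : S d → S d} (hΨ : Measurable Ψ) {A : ι → Set (S d)} (hA : ∀ k, MeasurableSet (A k))
    (hdis : Pairwise fun j k => Disjoint (A j) (A k)) {a : ι → ℝ≥0∞} (hAa : ∀ k, μ (A k) ≤ a k)
    (ha : ∑ k, a k = 1) {x : ι → S d} {ρ η : ℝ} (hη : 0 ≤ η)
    (hAx : ∀ k, ∀ z ∈ A k, geodDist (Ψ z) (x k) ≤ ρ) (hmass : 1 - η ≤ ∑ k, μ.real (A k)) :
    wasserstein2 (μ.map Ψ) (∑ k, a k • Measure.dirac (x k)) ≤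
      ENNReal.ofReal (ρ ^ 2 + Real.pi ^ 2 * η) ^ (1 / 2 : ℝ) := by
  set D : Set (S d) := (⋃ k, A k)ᶜ with hD
  have hUm : MeasurableSet (⋃ k, A k) := MeasurableSet.iUnion hA
  have hDm : MeasurableSet D := hUm.compl
  have hU : μ (⋃ k, A k) = ∑ k, μ (A k) := by
    rw [measure_iUnion hdis hA, tsum_fintype]
  have hsplit : μ = ∑ k, μ.restrict (A k) + μ.restrict D := by
    conv_lhs => rw [← Measure.restrict_add_restrict_compl (μ := μ) hUm]
    rw [Measure.restrict_iUnion hdis hA, Measure.sum_fintype]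
  set c := μ D with hc
  have hctop : c ≠ ∞ := measure_ne_top _ _
  -- The part of the target not yet filled. Its mass equals the mass `c` of the points outside all
  -- `A k`.
  set r : Measure (S d) := ∑ k, (a k - μ (A k)) • Measure.dirac (x k) with hr
  have hr_univ : r univ = c := by
    have h1 : ∑ k, (a k - μ (A k)) + ∑ k, μ (A k) = 1 := by
      rw [← Finset.sum_add_distrib, ← ha]
      exact Finset.sum_congr rfl fun k _ => tsub_add_cancel_of_le (hAa k)
    have h2 : c + ∑ k, μ (A k) = 1 := by
      rw [← hU, hc, hD, add_comm, measure_add_measure_compl hUm, measure_univ]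
    have h3 : ∑ k, μ (A k) ≠ ∞ := by rw [← hU]; exact measure_ne_top _ _
    have h4 : r univ = ∑ k, (a k - μ (A k)) := by
      simp [hr, Measure.finsetSum_apply]
    rw [h4]
    exact (ENNReal.add_left_inj h3).1 (h1.trans h2.symm)
  have : IsFiniteMeasure r := ⟨by rw [hr_univ]; exact hctop.lt_top⟩
  set m : Measure (S d) := (μ.restrict D).map Ψ with hm
  have hm_univ : m univ = c := by
    rw [hm, Measure.map_apply hΨ MeasurableSet.univ, preimage_univ, Measure.restrict_apply_univ]
  -- When `c = 0` the scalar `c⁻¹ * c` is `0`, not `1`, but then the measure vanishes as well.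
  have hcm : (c⁻¹ * c) • m = m := by
    rcases eq_or_ne c 0 with h0 | h0
    · have : m = 0 := by rw [← Measure.measure_univ_eq_zero, hm_univ, h0]
      rw [this, smul_zero]
    · rw [ENNReal.inv_mul_cancel h0 hctop, one_smul]
  have hcr : (c⁻¹ * c) • r = r := by
    rcases eq_or_ne c 0 with h0 | h0
    · have : r = 0 := by rw [← Measure.measure_univ_eq_zero, hr_univ, h0]
      rw [this, smul_zero]
    · rw [ENNReal.inv_mul_cancel h0 hctop, one_smul]
  have hpair : ∀ k, Measurable fun z : S d => (Ψ z, x k) := fun k => hΨ.prodMk measurable_const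
  -- Each `A k` is matched with its own target at cost at most `ρ ^ 2` per unit mass. The leftover
  -- is coupled as a normalized product, at cost at most `π ^ 2` per unit mass.
  set π : Measure (S d × S d) :=
    ∑ k, (μ.restrict (A k)).map (fun z => (Ψ z, x k)) + c⁻¹ • m.prod r with hπ
  have hcost : Measurable fun q : S d × S d => ENNReal.ofReal (geodDist q.1 q.2 ^ 2) :=
    (continuous_geodDist.pow 2).measurable.ennreal_ofReal
  have hfst : π.map Prod.fst = μ.map Ψ := by
    rw [hπ, Measure.map_add _ _ measurable_fst, Measure.map_smul, Measure.map_fst_prod, hr_univ, smul_smul, hcm]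
    conv_rhs => rw [hsplit, Measure.map_add _ _ hΨ]
    congr 1
    rw [Measure.map_finset_sum measurable_fst.aemeasurable,
      Measure.map_finset_sum hΨ.aemeasurable]
    refine Finset.sum_congr rfl fun k _ => ?_
    rw [Measure.map_map measurable_fst (hpair k)]
    rfl
  have hsnd : π.map Prod.snd = ∑ k, a k • Measure.dirac (x k) := by
    rw [hπ, Measure.map_add _ _ measurable_snd, Measure.map_smul, Measure.map_snd_prod, hm_univ, smul_smul, hcr,
      Measure.map_finset_sum measurable_snd.aemeasurable, hr, ← Finset.sum_add_distrib]
    refine Finset.sum_congr rfl fun k _ => ?_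
    rw [Measure.map_map measurable_snd (hpair k)]
    have : (Prod.snd ∘ fun z : S d => (Ψ z, x k)) = fun _ => x k := rfl
    rw [this, Measure.map_const, Measure.restrict_apply_univ, ← add_smul, add_comm,
      tsub_add_cancel_of_le (hAa k)]
  have hcη : c ≤ ENNReal.ofReal η := by
    have h1 : μ.real D = 1 - ∑ k, μ.real (A k) := by
      rw [hD, probReal_compl_eq_one_sub hUm, Measure.real, hU,
        ENNReal.toReal_sum fun k _ => measure_ne_top _ _]
      rfl
    rw [hc, ← ofReal_measureReal]
    exact ENNReal.ofReal_le_ofReal (by linarith)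
  have hint : ∫⁻ q, ENNReal.ofReal (geodDist q.1 q.2 ^ 2) ∂π ≤
      ENNReal.ofReal (ρ ^ 2 + Real.pi ^ 2 * η) := by
    rw [hπ, lintegral_add_measure, lintegral_finsetSum_measure,
      ENNReal.ofReal_add (by positivity) (by positivity)]
    refine add_le_add ?_ ?_
    · calc ∑ k, ∫⁻ q, ENNReal.ofReal (geodDist q.1 q.2 ^ 2)
              ∂((μ.restrict (A k)).map fun z => (Ψ z, x k))
          ≤ ∑ k, ENNReal.ofReal (ρ ^ 2) * μ (A k) := by
            refine Finset.sum_le_sum fun k _ => ?_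
            rw [lintegral_map hcost (hpair k), ← setLIntegral_const]
            refine setLIntegral_mono measurable_const fun z hz => ENNReal.ofReal_le_ofReal ?_
            exact pow_le_pow_left₀ (geodDist_nonneg _ _) (hAx k z hz) 2
        _ = ENNReal.ofReal (ρ ^ 2) * μ (⋃ k, A k) := by rw [← Finset.mul_sum, hU]
        _ ≤ ENNReal.ofReal (ρ ^ 2) * 1 := by gcongr; exact prob_le_one
        _ = _ := mul_one _
    · refine lintegral_sq_geodDist_le.trans ?_
      rw [ENNReal.ofReal_mul (by positivity)]
      gcongr
      refine le_trans ?_ hcη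
      rw [Measure.smul_apply, ← univ_prod_univ, Measure.prod_prod, hm_univ, hr_univ, smul_eq_mul,
        ← mul_assoc]
      exact mul_le_of_le_one_left zero_le (ENNReal.inv_mul_le_one c)
  refine ENNReal.rpow_le_rpow ?_ (by norm_num)
  exact (iInf₂_le (i := π) ⟨hfst, hsnd⟩).trans hint

lemma exists_pos_le_geodDist {ι : Type*} [Finite ι] {x : ι → S d} (hx : Function.Injective x) :
    ∃ m > 0, ∀ j k, j ≠ k → m ≤ geodDist (x j) (x k) := by
  classical
  rcases isEmpty_or_nonempty ι with h | h
  · exact ⟨1, one_pos, fun j => isEmptyElim j⟩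
  obtain ⟨q, hq⟩ := Finite.exists_min fun q : ι × ι =>
    if q.1 = q.2 then (1 : ℝ) else geodDist (x q.1) (x q.2)
  refine ⟨_, ?_, fun j k hjk => (hq (j, k)).trans (by simp [hjk])⟩
  split_ifs with hh
  · exact one_pos
  · exact geodDist_pos fun h => hh (hx h)

/-- An atomless probability measure carried by a closed geodesically convex set `C` can be steered
close to any discrete measure on `C` by a realizable map that preserves `C` and fixes a given
closed set disjoint from `C`. -/
theorem exists_steering {ι : Type*} [Fintype ι] (μ : Measure (S d)) [IsProbabilityMeasure μ]
    (hμ : ∀ y, μ {y} = 0) {C F : Set (S d)} (hCc : IsClosed C) (hC : GeodConvex C)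
    (hμC : μ Cᶜ = 0) (hF : IsClosed F) (hCF : Disjoint C F) {α : ι → ℝ} (hα : ∀ k, 0 ≤ α k)
    (hα1 : ∑ k, α k = 1) {x : ι → S d} (hxC : ∀ k, x k ∈ C) (hx : Function.Injective x) {ε : ℝ}
    (hε : 0 < ε) :
    ∃ g, Realizable g ∧ (∀ z ∈ F, g z = z) ∧ (∀ z ∈ C, g z ∈ C) ∧
      wasserstein2 (μ.map g) (∑ k, ENNReal.ofReal (α k) • Measure.dirac (x k)) ≤
        ENNReal.ofReal ε := by
  classical
  obtain ⟨m, hm, hmx⟩ := exists_pos_le_geodDist hx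
  -- The bound `m / 4` is what the four `ρ`-errors in `hsep` require; `ε / 2` controls the cost of
  -- the mass that is well placed.
  set ρ := min (m / 4) (ε / 2) with hρdef
  have hρ : 0 < ρ := lt_min (by positivity) (by positivity)
  have hρm : ρ ≤ m / 4 := min_le_left _ _
  have hρε : ρ ≤ ε / 2 := min_le_right _ _
  set n := Fintype.card ι with hn
  -- One loss `η` for the mass near the antipode of `p` and one for each of the `n` targets. Since
  -- `π ^ 2 ≤ 16`, the lost mass costs at most `ε ^ 2 / 2`, and the rest at most `ε ^ 2 / 4`.
  set η : ℝ := ε ^ 2 / 32 / (n + 1) with hηdef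
  have hη : 0 < η := by positivity
  -- the base point of the blob
  obtain ⟨p, hpC, hp⟩ : ∃ p ∈ C, ∀ k, p ≠ x k ∧ (p : E d) ≠ -(x k : E d) := by
    -- Otherwise `C`, which carries an atomless probability measure, would be finite.
    by_contra hcon
    push Not at hcon
    have hneg : ∀ k, -(x k : E d) ∈ Metric.sphere (0 : E d) 1 := fun k => by simp
    have hfin : (range x ∪ range fun k => (⟨-(x k : E d), hneg k⟩ : S d)).Finite :=
      (finite_range _).union (finite_range _)
    have hnull : μ (range x ∪ range fun k => (⟨-(x k : E d), hneg k⟩ : S d)) = 0 := by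
      have : NullSingletonClass μ := ⟨hμ⟩
      exact hfin.measure_zero μ
    have hsub : C ⊆ range x ∪ range fun k => (⟨-(x k : E d), hneg k⟩ : S d) := by
      intro y hy
      obtain ⟨k, hk⟩ := hcon y hy
      by_cases hyk : y = x k
      · exact Or.inl ⟨k, hyk.symm⟩
      · exact Or.inr ⟨k, Subtype.ext (hk hyk).symm⟩
    have h1 : μ C = 0 := measure_mono_null hsub hnull
    have h2 : μ univ ≤ 0 := by
      rw [← union_compl_self C]
      exact (measure_union_le _ _).trans (by rw [h1, hμC, add_zero])
    simp at h2
  -- most of the mass lies away from the antipode of `p`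
  obtain ⟨δ, hδ, hδmass⟩ : ∃ δ > 0, 1 - η ≤ μ.real (C ∩ {y | geodDist y p ≤ Real.pi - δ}) := by
    have hlim := tendsto_real_of_monotone μ
      (s := fun n : ℕ => C ∩ {y | geodDist y p ≤ Real.pi - 1 / ((n : ℝ) + 1)})
      (fun i j hij => inter_subset_inter_right _ fun y hy => by
        have h1 : 1 / ((j : ℝ) + 1) ≤ 1 / ((i : ℝ) + 1) := Nat.one_div_le_one_div hij
        have h2 : geodDist y p ≤ Real.pi - 1 / ((i : ℝ) + 1) := hy
        show geodDist y p ≤ Real.pi - 1 / ((j : ℝ) + 1)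
        linarith)
    have hU : μ.real (⋃ n : ℕ, C ∩ {y | geodDist y p ≤ Real.pi - 1 / ((n : ℝ) + 1)}) = 1 := by
      have hneg : -(p : E d) ∈ Metric.sphere (0 : E d) 1 := by simp
      have hsub : (⋃ n : ℕ, C ∩ {y | geodDist y p ≤ Real.pi - 1 / ((n : ℝ) + 1)})ᶜ ⊆
          Cᶜ ∪ {⟨-(p : E d), hneg⟩} := by
        intro y hy
        by_cases hyC : y ∈ C
        · right
          rw [mem_singleton_iff]
          by_contra hne
          have hlt : geodDist y p < Real.pi := lt_of_le_of_ne (geodDist_le_pi _ _) fun h =>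
            hne (Subtype.ext (by
              rw [geodDist_eq_pi_iff] at h
              simp [h]))
          obtain ⟨n, hn⟩ := exists_nat_one_div_lt (sub_pos.2 hlt)
          refine hy (mem_iUnion.2 ⟨n, hyC, ?_⟩)
          show geodDist y p ≤ Real.pi - 1 / ((n : ℝ) + 1)
          linarith
        · exact Or.inl hyC
      have h0 : μ (⋃ n : ℕ, C ∩ {y | geodDist y p ≤ Real.pi - 1 / ((n : ℝ) + 1)})ᶜ = 0 :=
        measure_mono_null hsub (measure_union_null hμC (hμ _))
      have hms : MeasurableSet (⋃ n : ℕ, C ∩ {y | geodDist y p ≤ Real.pi - 1 / ((n : ℝ) + 1)}) :=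
        MeasurableSet.iUnion fun n => hCc.measurableSet.inter
          (isClosed_le (continuous_geodDist_right p) continuous_const).measurableSet
      rw [Measure.real, (prob_compl_eq_zero_iff hms).1 h0, ENNReal.toReal_one]
    rw [hU] at hlim
    obtain ⟨n, hn⟩ := (hlim.eventually (lt_mem_nhds (show 1 - η < 1 by linarith))).exists
    exact ⟨1 / ((n : ℝ) + 1), Nat.one_div_pos_of_nat, hn.le⟩
  set K : Set (S d) := C ∩ {y | geodDist y p ≤ Real.pi - δ} with hK
  have hKc : IsClosed K := hCc.inter (isClosed_le (continuous_geodDist_right p) continuous_const)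
  -- The component of `p` orthogonal to `x k`. It pairs positively with `p` because `p ≠ ± x k`,
  -- hence also with all points of a small enough blob.
  set v : ι → E d := fun k => (p : E d) - (inner ℝ (p : E d) (x k : E d) : ℝ) • (x k : E d) with hv
  have hvx : ∀ k, inner ℝ (v k) (x k : E d) = (0 : ℝ) := by
    intro k
    simp only [hv, inner_sub_left, inner_smul_left, inner_self_sphere]
    simp
  have hvp : ∀ k, 0 < (inner ℝ (v k) (p : E d) : ℝ) := by
    intro k
    have h1 : (inner ℝ (v k) (p : E d) : ℝ) = 1 - (inner ℝ (p : E d) (x k : E d) : ℝ) ^ 2 := by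
      simp only [hv, inner_sub_left, inner_smul_left, inner_self_sphere]
      rw [real_inner_comm (p : E d) (x k : E d)]
      simp [sq]
    have h2 := abs_real_inner_le_norm (p : E d) (x k : E d)
    rw [norm_coe_sphere, norm_coe_sphere, mul_one, abs_le] at h2
    have h3 : (inner ℝ (p : E d) (x k : E d) : ℝ) ≠ 1 := fun h => (hp k).1 (Subtype.ext
      ((inner_eq_one_iff_of_norm_eq_one (𝕜 := ℝ) (norm_coe_sphere _) (norm_coe_sphere _)).1 h))
    have h4 : (inner ℝ (p : E d) (x k : E d) : ℝ) ≠ -1 := fun h => (hp k).2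
      ((inner_eq_neg_one_iff_of_norm_eq_one (norm_coe_sphere _) (norm_coe_sphere _)).1 h)
    have h5 := lt_of_le_of_ne h2.1 h4.symm
    have h6 := lt_of_le_of_ne h2.2 h3
    rw [h1]; nlinarith
  set O : Set (S d) := {z | geodDist z p < ρ} ∩ ⋂ k, {z | 0 < (inner ℝ (v k) (z : E d) : ℝ)} with hO
  have hOo : IsOpen O := (isOpen_lt (continuous_geodDist_right p) continuous_const).inter
    (isOpen_iInter_of_finite fun k => isOpen_lt continuous_const (by fun_prop))
  have hpO : p ∈ O := ⟨by simpa [geodDist_self] using hρ, mem_iInter.2 hvp⟩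
  obtain ⟨g₁, hg₁, hg₁b, hg₁F, hg₁K⟩ := exists_collapse (w := p) (K := K) (F := F) (O := O) hKc
    (fun y hy z hz => ⟨hC y hy.1 p hpC z hz, hz.geodDist_le.trans hy.2⟩)
    (fun y hy hyp => by
      have h1 : geodDist y p ≤ Real.pi - δ := hy.2
      rw [geodDist_eq_pi_iff.2 (by rw [hyp, neg_neg])] at h1
      linarith) hF (hCF.mono_left inter_subset_left) hOo hpO
  have hg₁C : ∀ z ∈ C, g₁ z ∈ C := fun z hz => hC z hz p hpC _ (hg₁b z)
  have hg₁m : Measurable g₁ := hg₁.continuous.measurable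
  set Q : Set (S d) := g₁ '' K with hQ
  have hQc : IsClosed Q := (hKc.isCompact.image hg₁.continuous).isClosed
  have hQC : Q ⊆ C := by rintro _ ⟨z, hz, rfl⟩; exact hg₁C z hz.1
  have hQO : Q ⊆ O := by rintro _ ⟨z, hz, rfl⟩; exact hg₁K z hz
  set ν : Measure (S d) := μ.map g₁ with hν
  have hνfin : IsFiniteMeasure ν := by rw [hν]; infer_instance
  have hνatom : ∀ y, ν {y} = 0 := by
    intro y
    rw [hν, Measure.map_apply hg₁m (measurableSet_singleton y)]
    have hsub : (g₁ ⁻¹' {y}).Subsingleton := fun a ha b hb => hg₁.injective (by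
      rw [mem_preimage, mem_singleton_iff] at ha hb; rw [ha, hb])
    have : NullSingletonClass μ := ⟨hμ⟩
    exact hsub.measure_zero μ
  have hνQ : 1 - η ≤ ν.real Q := by
    rw [hν, map_measureReal_apply hg₁m hQc.measurableSet]
    exact hδmass.trans (measureReal_mono (subset_preimage_image g₁ K))
  -- A geodesic from the blob to `x k` passing within `ρ` of `x j` would have length above `d(p, x
  -- j) + m - 3 ρ`, whereas its length is below `d(p, x k) + ρ`. This contradicts `4 ρ ≤ m`.
  have hsep : ∀ j k, j ≠ k → geodDist p (x k) ≤ geodDist p (x j) →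
      Disjoint (starHull (x k) Q) {y | geodDist y (x j) ≤ ρ} := by
    intro j k hjk hle
    rw [disjoint_left]
    rintro z ⟨y, hy, hb⟩ hzj
    have h1 : geodDist z (x j) ≤ ρ := hzj
    have h2 : geodDist y p < ρ := (hQO hy).1
    have h3 := hmx j k hjk
    have h4 := geodDist_triangle y p (x k)
    have h5 := geodDist_triangle (x j) z (x k)
    have h6 := geodDist_triangle p y z
    have h7 := geodDist_triangle p z (x j)
    rw [geodDist_comm (x j) z] at h5
    rw [geodDist_comm p y] at h6
    unfold Btw at hb
    linarith
  obtain ⟨g₂, hg₂, hg₂F, hg₂C, L, hL, hLdis, hLge⟩ := exists_distribution ν hνatom hC hxC hvx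
    (fun k z hz => mem_iInter.1 (hQO hz).2 k) hρ hsep hα hη n Finset.univ rfl Q F hQc subset_rfl
    hF (fun k _ => hCF.mono_left (hC.starHull_subset (hxC k) hQC))
  have hg₂m : Measurable g₂ := hg₂.continuous.measurable
  refine ⟨_, hg₂.comp hg₁, fun z hz => by rw [hg₁F z hz, hg₂F z hz],
    fun z hz => hg₂C _ (hg₁C z hz), ?_⟩
  have hmeas : ∀ k, μ.real (g₁ ⁻¹' L k) = ν.real (L k) := fun k => by
    rw [hν, map_measureReal_apply hg₁m (hL k (Finset.mem_univ k)).1.measurableSet]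
  refine (wasserstein2_le μ (hg₂m.comp hg₁m) (A := fun k => g₁ ⁻¹' L k)
    (a := fun k => ENNReal.ofReal (α k)) (η := (n + 1) * η)
    (fun k => hg₁m (hL k (Finset.mem_univ k)).1.measurableSet)
    (fun j k hjk => (hLdis j (Finset.mem_univ j) k (Finset.mem_univ k) hjk).preimage g₁)
    (fun k => ?_) ?_ (by positivity)
    (fun k z hz => (hL k (Finset.mem_univ k)).2.2.1 _ hz) ?_).trans ?_
  · rw [← ofReal_measureReal, hmeas]
    exact ENNReal.ofReal_le_ofReal (hL k (Finset.mem_univ k)).2.2.2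
  · rw [← ENNReal.ofReal_sum_of_nonneg fun k _ => hα k, hα1, ENNReal.ofReal_one]
  · simp only [hmeas]
    rw [hα1] at hLge
    have h1 : 1 - η ≤ min 1 (ν.real Q) := le_min (by linarith) hνQ
    linarith
  · have h1 : (n + 1) * η = ε ^ 2 / 32 := by
      rw [hηdef]; field_simp
    have h2 : ρ ^ 2 + Real.pi ^ 2 * ((n + 1) * η) ≤ ε ^ 2 := by
      have h3 : Real.pi ^ 2 ≤ 16 := by nlinarith [Real.pi_pos, Real.pi_le_four]
      have h4 : ρ ^ 2 ≤ (ε / 2) ^ 2 := pow_le_pow_left₀ hρ.le hρε 2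
      have h5 : Real.pi ^ 2 * (ε ^ 2 / 32) ≤ 16 * (ε ^ 2 / 32) :=
        mul_le_mul_of_nonneg_right h3 (by positivity)
      rw [h1]
      nlinarith [sq_nonneg ε]
    calc ENNReal.ofReal (ρ ^ 2 + Real.pi ^ 2 * ((n + 1) * η)) ^ (1 / 2 : ℝ)
        ≤ ENNReal.ofReal (ε ^ 2) ^ (1 / 2 : ℝ) :=
          ENNReal.rpow_le_rpow (ENNReal.ofReal_le_ofReal h2) (by norm_num)
      _ = ENNReal.ofReal ε := by
          rw [ENNReal.ofReal_rpow_of_nonneg (by positivity) (by norm_num), ← Real.sqrt_eq_rpow,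
            Real.sqrt_sq hε.le]

/-! ### From realizable maps to piecewise constant parameters and weak solutions. -/

/-- The parameters `(W, U, b)` of a layer without self-attention. -/
abbrev Layer (d : ℕ) : Type := Matrix (Fin d) (Fin d) ℝ × Matrix (Fin d) (Fin d) ℝ × E d

/-- The velocity field of a layer. -/
noncomputable def Layer.vel (A : Layer d) (x : S d) : E d := TransformerFlow.vel A.1 A.2.1 A.2.2 x

/-- Scaling `W` by `τ⁻¹` runs a unit-time layer in time `τ`, so any horizon can be reached. -/
lemma vel_smul (r : ℝ) (W U : Matrix (Fin d) (Fin d) ℝ) (b : E d) (x : S d) :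
    vel (r • W) U b x = r • vel W U b x := by
  have h : ∀ y : E d, act (r • W) y = r • act W y := fun y => by
    ext j; simp [act, Matrix.smul_mulVec]
  rw [vel, vel, h, proj, proj, inner_smul_right, smul_sub, smul_smul]

lemma continuous_act (A : Matrix (Fin d) (Fin d) ℝ) : Continuous (act A) := by
  unfold act
  have : Continuous fun x : E d => A.mulVec (WithLp.ofLp x) :=
    Continuous.matrix_mulVec continuous_const (by fun_prop)
  fun_prop

lemma continuous_relu : Continuous (relu : E d → E d) := by
  unfold relu
  fun_prop

lemma Layer.continuous_vel (A : Layer d) : Continuous A.vel := by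
  unfold Layer.vel TransformerFlow.vel proj
  have h : Continuous fun x : S d => act A.1 (relu (act A.2.1 (x : E d) + A.2.2)) :=
    (continuous_act _).comp (continuous_relu.comp
      (((continuous_act _).comp continuous_subtype_val).add continuous_const))
  fun_prop

/-- `X` follows the layer `A k` on the time interval `[k τ, (k+1) τ)`, for `k < n`. -/
structure IsTrajectory (τ : ℝ) (n : ℕ) (A : ℕ → Layer d) (X : ℝ → S d → S d) : Prop where
  continuous : Continuous fun p : ℝ × S d => X p.1 p.2
  of_nonpos : ∀ t ≤ 0, ∀ x, X t x = x
  hasDeriv : ∀ k < n, ∀ t ∈ Ico (k * τ) ((k + 1) * τ), ∀ x,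
    HasDerivWithinAt (fun s => (X s x : E d)) ((A k).vel (X t x)) (Ici t) t

/-- The number of layers is fixed before `τ`, so that `τ = T / n` can be chosen afterwards. The
identity is given one null layer to ensure `n ≥ 1`. -/
theorem Realizable.exists_trajectory {g : S d → S d} (hg : Realizable g) :
    ∃ n : ℕ, 1 ≤ n ∧ ∀ τ : ℝ, 0 < τ → ∃ (A : ℕ → Layer d) (X : ℝ → S d → S d),
      IsTrajectory τ n A X ∧ ∀ t, n * τ ≤ t → ∀ x, X t x = g x := by
  induction hg with
  | id =>
    refine ⟨1, le_rfl, fun τ hτ => ⟨fun _ => (0, 0, 0), fun _ x => x,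
      ⟨continuous_snd, fun _ _ _ => rfl, fun k _ t _ x => ?_⟩, fun _ _ _ => rfl⟩⟩
    have : Layer.vel (d := d) (0, 0, 0) x = 0 := by
      simp [Layer.vel, vel, act, proj]
    rw [this]
    exact hasDerivWithinAt_const _ _ _
  | @step W U b Φ g hΦ _ ih =>
    obtain ⟨n, hn, ih⟩ := ih
    refine ⟨n + 1, by omega, fun τ hτ => ?_⟩
    obtain ⟨A, X, hX, hXg⟩ := ih τ hτ
    -- The composite is a concatenation: `Φ` is still the identity before time `n * τ`, and `X` is
    -- frozen at `g` after it.
    have hid : ∀ s ≤ n * τ, ∀ x, Φ ((s - n * τ) / τ) (X s x) = X s x := fun s hs x =>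
      hΦ.of_nonpos _ (div_nonpos_of_nonpos_of_nonneg (by linarith) hτ.le) _
    refine ⟨fun k => if k < n then A k else (τ⁻¹ • W, U, b),
      fun t x => Φ ((t - n * τ) / τ) (X t x), ⟨?_, ?_, ?_⟩, ?_⟩
    · have h1 : Continuous fun p : ℝ × S d => ((p.1 - n * τ) / τ, X p.1 p.2) :=
        Continuous.prodMk (by fun_prop) hX.continuous
      exact hΦ.continuous.comp h1
    · intro t ht x
      rw [hid t (ht.trans (by positivity)) x]
      exact hX.of_nonpos t ht x
    · intro k hk t ht x
      rcases Nat.lt_succ_iff_lt_or_eq.1 hk with hk | rfl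
      · have hkn : ((k : ℝ) + 1) * τ ≤ n * τ := by
          have : ((k : ℝ) + 1) ≤ n := by exact_mod_cast hk
          exact mul_le_mul_of_nonneg_right this hτ.le
        rw [if_pos hk, hid t (ht.2.le.trans hkn)]
        refine (hX.hasDeriv k hk t ht x).congr_of_eventuallyEq ?_ ?_
        · have : ∀ᶠ s in 𝓝[≥] t, s < n * τ :=
            mem_nhdsWithin_of_mem_nhds (gt_mem_nhds (ht.2.trans_le hkn))
          filter_upwards [this] with s hs
          rw [hid s hs.le]
        · rw [hid t (ht.2.le.trans hkn)]
      · rw [if_neg (lt_irrefl _), Layer.vel, vel_smul]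
        have hmem : (t - k * τ) / τ ∈ Ico (0 : ℝ) 1 := by
          constructor
          · exact div_nonneg (by linarith [ht.1]) hτ.le
          · rw [div_lt_one hτ]; linarith [ht.2]
        have h1 := hΦ.hasDeriv (g x) _ hmem
        have h2 : HasDerivWithinAt (fun s : ℝ => (s - k * τ) / τ) τ⁻¹ (Ici t) t := by
          have := (((hasDerivAt_id t).sub_const (k * τ)).div_const τ).hasDerivWithinAt (s := Ici t)
          simpa using this
        have h3 := h1.scomp t h2 (fun s (hs : t ≤ s) => by
          show (t - k * τ) / τ ≤ (s - k * τ) / τ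
          gcongr)
        rw [hXg t ht.1]
        refine h3.congr_of_eventuallyEq ?_ ?_
        · filter_upwards [self_mem_nhdsWithin] with s (hs : t ≤ s)
          simp only [Function.comp_apply]
          rw [hXg s (ht.1.trans hs)]
        · simp only [Function.comp_apply]
          rw [hXg t ht.1]
    · intro t ht x
      push_cast at ht
      show Φ ((t - n * τ) / τ) (X t x) = Φ 1 (g x)
      rw [hXg t (by linarith), hΦ.of_one_le]
      rw [le_div_iff₀ hτ]; linarith

lemma floor_mem_Ico {τ t : ℝ} (hτ : 0 < τ) (ht : 0 ≤ t) :
    t ∈ Ico ((⌊t / τ⌋₊ : ℝ) * τ) ((⌊t / τ⌋₊ + 1) * τ) := by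
  constructor
  · rw [← le_div_iff₀ hτ]; exact Nat.floor_le (by positivity)
  · rw [← div_lt_iff₀ hτ]; exact Nat.lt_floor_add_one _

lemma floor_eq_of_mem_Ico {τ t : ℝ} (hτ : 0 < τ) {k : ℕ} (ht : t ∈ Ico ((k : ℝ) * τ) ((k + 1) * τ)) :
    ⌊t / τ⌋₊ = k := by
  have h0 : 0 ≤ t := le_trans (by positivity) ht.1
  rw [Nat.floor_eq_iff (by positivity)]
  exact ⟨(le_div_iff₀ hτ).2 ht.1, (div_lt_iff₀ hτ).2 ht.2⟩

/-- The time-dependent parameters equal to `A k` on `[k τ, (k+1) τ)`, without self-attention. -/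
noncomputable def schedule (τ : ℝ) (A : ℕ → Layer d) (B : ℝ → Matrix (Fin d) (Fin d) ℝ) (t : ℝ) :
    Params d :=
  ⟨0, B t, (A ⌊t / τ⌋₊).1, (A ⌊t / τ⌋₊).2.1, (A ⌊t / τ⌋₊).2.2⟩

lemma velocity_schedule (τ : ℝ) (A : ℕ → Layer d) (B : ℝ → Matrix (Fin d) (Fin d) ℝ) (t : ℝ)
    (μ : Measure (S d)) (x : S d) :
    velocity (schedule τ A B t) μ x = (A ⌊t / τ⌋₊).vel x :=
  velocity_zero_eq _ _ _ _ _ _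

lemma continuous_fderiv_apply {φ : E d → ℝ} (hφ : ContDiff ℝ 1 φ) {v : S d → E d}
    (hv : Continuous v) : Continuous fun x : S d => fderiv ℝ φ (x : E d) (v x) :=
  ((hφ.continuous_fderiv one_ne_zero).comp continuous_subtype_val).clm_apply hv

lemma integrable_of_continuous_sphere {μ : Measure (S d)} [IsFiniteMeasure μ] {f : S d → ℝ}
    (hf : Continuous f) : Integrable f μ :=
  hf.integrable_of_hasCompactSupport (HasCompactSupport.of_compactSpace f)

lemma IsTrajectory.measurable {τ : ℝ} {n : ℕ} {A : ℕ → Layer d} {X : ℝ → S d → S d}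
    (hX : IsTrajectory τ n A X) (t : ℝ) : Measurable (X t) := by
  have h := hX.continuous.comp (Continuous.prodMk_right t)
  exact Continuous.measurable h

lemma IsTrajectory.continuous_time {τ : ℝ} {n : ℕ} {A : ℕ → Layer d} {X : ℝ → S d → S d}
    (hX : IsTrajectory τ n A X) (x : S d) : Continuous fun t => X t x := by
  have h := hX.continuous.comp (Continuous.prodMk_left x)
  exact h

/-- The push-forward of the initial datum by a trajectory is a weak solution. -/
theorem IsTrajectory.isWeakSolution {τ : ℝ} (hτ : 0 < τ) {n : ℕ} {A : ℕ → Layer d}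
    {X : ℝ → S d → S d} (hX : IsTrajectory τ n A X) (B : ℝ → Matrix (Fin d) (Fin d) ℝ)
    (μ₀ : ProbabilityMeasure (S d)) :
    IsWeakSolution (n * τ) (schedule τ A B) μ₀
      (fun t => μ₀.map (f := X t) (hX.measurable t).aemeasurable) := by
  have hT : 0 ≤ n * τ := by positivity
  have hcont : Continuous fun t => μ₀.map (f := X t) (hX.measurable t).aemeasurable := by
    rw [continuous_iff_continuousAt]
    intro t
    rw [ContinuousAt, ProbabilityMeasure.tendsto_iff_forall_integral_tendsto]
    intro f
    simp only [ProbabilityMeasure.toMeasure_map]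
    have h1 : ∀ s, ∫ x, f x ∂((μ₀ : Measure (S d)).map (X s)) = ∫ x, f (X s x) ∂(μ₀ : Measure (S d)) :=
      fun s => integral_map (hX.measurable s).aemeasurable f.continuous.aestronglyMeasurable
    simp only [h1]
    have h2 : Continuous fun s => ∫ x, f (X s x) ∂(μ₀ : Measure (S d)) := by
      refine continuous_of_dominated (bound := fun _ => ‖f‖)
        (fun s => (f.continuous.measurable.comp (hX.measurable s)).aestronglyMeasurable)
        (fun s => Eventually.of_forall fun x => f.norm_coe_le_norm _) (integrable_const _)
        (Eventually.of_forall fun x => f.continuous.comp (hX.continuous_time x))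
    exact h2.tendsto t
  -- the integrand along trajectories
  have key : ∀ φ : E d → ℝ, ContDiff ℝ 1 φ → ∃ G : ℝ → S d → ℝ,
      (∀ s, ∫ x : S d, fderiv ℝ φ (x : E d) (velocity (schedule τ A B s)
        ((μ₀ : Measure (S d)).map (X s)) x) ∂((μ₀ : Measure (S d)).map (X s)) =
          ∫ x, G s x ∂(μ₀ : Measure (S d))) ∧
      Integrable (Function.uncurry G)
        ((volume.restrict (Ioc 0 (n * τ))).prod (μ₀ : Measure (S d))) ∧
      (∀ x, IntervalIntegrable (fun s => G s x) volume 0 (n * τ)) ∧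
      ∀ x, ∀ s ∈ Ico 0 (n * τ),
        HasDerivWithinAt (fun s => φ (X s x : E d)) (G s x) (Ici s) s := by
    intro φ hφ
    set H : ℕ × S d → ℝ := fun q => fderiv ℝ φ (q.2 : E d) ((A q.1).vel q.2) with hH
    have hHc : ∀ k, Continuous fun y => H (k, y) := fun k =>
      continuous_fderiv_apply hφ (A k).continuous_vel
    -- Continuity in the point for each of countably many layers gives the joint measurability that
    -- Fubini needs.
    have hHm : Measurable H := measurable_from_prod_countable_right fun k => (hHc k).measurable
    choose c hc using fun k => isCompact_univ.exists_bound_of_continuousOn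
      (hHc k).continuousOn
    -- The range goes up to `n` because the floor equals `n` at the final time `n * τ`.
    set K := ∑ k ∈ Finset.range (n + 1), |c k| with hK
    have hbound : ∀ s ∈ Icc 0 (n * τ), ∀ y, ‖H (⌊s / τ⌋₊, y)‖ ≤ K := by
      intro s hs y
      have h1 : ⌊s / τ⌋₊ ∈ Finset.range (n + 1) := by
        rw [Finset.mem_range, Nat.lt_succ_iff]
        refine Nat.floor_le_of_le ?_
        rw [div_le_iff₀ hτ]; exact hs.2
      exact ((hc _ y (mem_univ y)).trans (le_abs_self _)).trans
        (Finset.single_le_sum (f := fun k => |c k|) (fun k _ => abs_nonneg _) h1)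
    have hmap : Measurable fun q : ℝ × S d => (⌊q.1 / τ⌋₊, X q.1 q.2) :=
      (Nat.measurable_floor.comp (measurable_fst.div_const τ)).prodMk hX.continuous.measurable
    have hGm : Measurable fun q : ℝ × S d => H (⌊q.1 / τ⌋₊, X q.1 q.2) := hHm.comp hmap
    refine ⟨fun s x => H (⌊s / τ⌋₊, X s x), fun s => ?_, ?_, fun x => ?_, fun x s hs => ?_⟩
    · rw [integral_map (hX.measurable s).aemeasurable]
      · refine integral_congr_ae (Eventually.of_forall fun x => ?_)
        simp only [hH, velocity_schedule]
      · simp only [velocity_schedule]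
        exact (hHc _).aestronglyMeasurable
    · refine Integrable.of_bound hGm.aestronglyMeasurable K ?_
      have h1 : ∀ᵐ s ∂(volume.restrict (Ioc 0 (n * τ))), s ∈ Ioc 0 (n * τ) :=
        ae_restrict_mem measurableSet_Ioc
      have h2 : ∀ᵐ q : ℝ × S d ∂((volume.restrict (Ioc 0 (n * τ))).prod (μ₀ : Measure (S d))),
          q.1 ∈ Ioc 0 (n * τ) := Measure.quasiMeasurePreserving_fst.ae h1
      filter_upwards [h2] with q hq
      exact hbound q.1 (Ioc_subset_Icc_self hq) _
    · rw [intervalIntegrable_iff_integrableOn_Ioc_of_le hT]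
      refine Integrable.of_bound
        (hGm.comp (measurable_id.prodMk measurable_const)).aestronglyMeasurable K ?_
      filter_upwards [ae_restrict_mem measurableSet_Ioc] with s hs
      exact hbound s (Ioc_subset_Icc_self hs) _
    · have hk : ⌊s / τ⌋₊ < n := by
        rw [Nat.floor_lt (div_nonneg hs.1 hτ.le), div_lt_iff₀ hτ]; exact hs.2
      have h1 := hX.hasDeriv _ hk s (floor_mem_Ico hτ hs.1) x
      exact ((hφ.differentiable one_ne_zero) _).hasFDerivAt.comp_hasDerivWithinAt s h1
  refine ⟨hcont.continuousOn, ?_, fun φ hφ => ?_, fun φ hφ t ht => ?_⟩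
  · have h0 : X 0 = id := funext fun x => hX.of_nonpos 0 le_rfl x
    have h1 : (μ₀ : Measure (S d)).map (X 0) = μ₀ := by rw [h0, Measure.map_id]
    exact Subtype.ext h1
  · obtain ⟨G, hG, hGi, -, -⟩ := key φ hφ
    simp only [ProbabilityMeasure.toMeasure_map, hG]
    rw [intervalIntegrable_iff_integrableOn_Ioc_of_le hT]
    exact hGi.integral_prod_left
  · obtain ⟨G, hG, hGi, hGx, hGd⟩ := key φ hφ
    simp only [ProbabilityMeasure.toMeasure_map, hG]
    have hφc : Continuous fun x : S d => φ (x : E d) := hφ.continuous.comp continuous_subtype_val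
    rw [integral_map (hX.measurable t).aemeasurable hφc.aestronglyMeasurable]
    have hsub : ∀ x, IntervalIntegrable (fun s => G s x) volume 0 t := fun x =>
      (hGx x).mono_set (by rw [uIcc_of_le ht.1, uIcc_of_le hT]; exact Icc_subset_Icc_right ht.2)
    have hftc : ∀ x, φ (X t x : E d) = φ (x : E d) + ∫ s in (0 : ℝ)..t, G s x := by
      intro x
      have h1 := intervalIntegral.integral_eq_sub_of_hasDeriv_right_of_le ht.1
        (f := fun s => φ (X s x : E d)) (f' := fun s => G s x)
        (hφc.comp (hX.continuous_time x)).continuousOn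
        (fun s hs => (hGd x s ⟨hs.1.le, hs.2.trans_le ht.2⟩).mono Ioi_subset_Ici_self) (hsub x)
      rw [h1, hX.of_nonpos 0 le_rfl]
      ring
    simp only [hftc]
    have hGi' : Integrable (Function.uncurry G)
        ((volume.restrict (Ioc 0 t)).prod (μ₀ : Measure (S d))) :=
      hGi.mono_measure (Measure.prod_mono (Measure.restrict_mono
        (Ioc_subset_Ioc_right ht.2) le_rfl) le_rfl)
    have hint : Integrable (fun x => ∫ s in (0 : ℝ)..t, G s x) (μ₀ : Measure (S d)) := by
      simp only [intervalIntegral.integral_of_le ht.1]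
      exact hGi'.integral_prod_right
    rw [integral_add (integrable_of_continuous_sphere hφc) hint]
    congr 1
    simp only [intervalIntegral.integral_of_le ht.1]
    exact (integral_integral_swap hGi').symm

/-! ### Uniqueness of weak solutions by a dual Euler scheme. -/

/-- A Lipschitz map is uniformly close to `C¹` maps with the same Lipschitz constant. -/
lemma exists_contDiff_lipschitz_approx {V : E d → E d} {K : ℝ≥0} (hV : LipschitzWith K V) {δ : ℝ}
    (hδ : 0 < δ) :
    ∃ u : E d → E d, ContDiff ℝ 1 u ∧ LipschitzWith K u ∧ ∀ x, ‖u x - V x‖ ≤ δ := by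
  have hK : (0 : ℝ) < K + 1 := by positivity
  set r : ℝ := δ / (K + 1) with hr
  have hrpos : 0 < r := by positivity
  -- Mollification at scale `r` averages translates, so it keeps the constant `K` and moves values
  -- by at most `K r ≤ δ`.
  set φ : ContDiffBump (0 : E d) := ⟨r / 2, r, half_pos hrpos, half_lt_self hrpos⟩ with hφ
  have hφi : ∀ x, Integrable (fun t => φ.normed volume t • V (x - t)) := fun x =>
    (φ.hasCompactSupport_normed (μ := volume)).convolutionExists_left
      (ContinuousLinearMap.lsmul ℝ ℝ) φ.continuous_normed hV.continuous.locallyIntegrable x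
  refine ⟨convolution (φ.normed volume) V (ContinuousLinearMap.lsmul ℝ ℝ) volume, ?_, ?_, ?_⟩
  · exact φ.hasCompactSupport_normed.contDiff_convolution_left _ φ.contDiff_normed
      hV.continuous.locallyIntegrable
  · refine LipschitzWith.of_dist_le_mul fun x y => ?_
    rw [dist_eq_norm, convolution_def, convolution_def]
    simp only [ContinuousLinearMap.lsmul_apply]
    rw [← integral_sub (hφi x) (hφi y)]
    calc ‖∫ t, φ.normed volume t • V (x - t) - φ.normed volume t • V (y - t)‖
        ≤ ∫ t, φ.normed volume t * (K * dist x y) := by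
          refine norm_integral_le_of_norm_le (φ.integrable_normed.mul_const _)
            (Eventually.of_forall fun t => ?_)
          rw [← smul_sub, norm_smul, Real.norm_eq_abs, abs_of_nonneg (φ.nonneg_normed t)]
          refine mul_le_mul_of_nonneg_left ?_ (φ.nonneg_normed t)
          have := hV.dist_le_mul (x - t) (y - t)
          rwa [dist_eq_norm, dist_sub_right] at this
      _ = K * dist x y := by rw [integral_mul_const, φ.integral_normed, one_mul]
  · intro x
    rw [← dist_eq_norm]
    refine φ.dist_normed_convolution_le hV.continuous.aestronglyMeasurable fun y hy => ?_
    have h1 : dist y x ≤ r := (Metric.mem_ball.1 hy).le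
    calc dist (V y) (V x) ≤ K * dist y x := hV.dist_le_mul y x
      _ ≤ (K + 1) * r := by gcongr; linarith
      _ = δ := by rw [hr]; field_simp

lemma contDiff_act (A : Matrix (Fin d) (Fin d) ℝ) : ContDiff ℝ 1 (act A) := by
  have h : act A = (Matrix.toEuclideanLin A).toContinuousLinearMap := by
    ext x; rfl
  rw [h]
  exact ContinuousLinearMap.contDiff _

lemma lipschitzWith_relu : LipschitzWith 1 (relu : E d → E d) := by
  refine LipschitzWith.of_dist_le_mul fun x y => ?_
  rw [NNReal.coe_one, one_mul, EuclideanSpace.dist_eq, EuclideanSpace.dist_eq]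
  refine Real.sqrt_le_sqrt (Finset.sum_le_sum fun i _ => ?_)
  refine pow_le_pow_left₀ dist_nonneg ?_ 2
  simp only [relu, Real.dist_eq]
  simpa using abs_max_sub_max_le_max (x i) 0 (y i) 0

/-- The ambient formula is locally Lipschitz, hence Lipschitz on the compact sphere. A globally
Lipschitz extension is what can be mollified in the uniqueness proof. -/
lemma Layer.exists_lipschitz_extension (A : Layer d) :
    ∃ (V : E d → E d) (K : ℝ≥0), LipschitzWith K V ∧ ∀ x : S d, V x = A.vel x := by
  set V₀ : E d → E d := fun x => act A.1 (relu (act A.2.1 x + A.2.2)) -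
    (inner ℝ x (act A.1 (relu (act A.2.1 x + A.2.2))) : ℝ) • x with hV₀
  have h1 : LocallyLipschitz fun x : E d => relu (act A.2.1 x + A.2.2) := by
    have h2 : ContDiff ℝ 1 fun x : E d => act A.2.1 x + A.2.2 := (contDiff_act _).add contDiff_const
    have h3 := lipschitzWith_relu.locallyLipschitz.comp h2.locallyLipschitz
    exact h3
  have h4 : LocallyLipschitz fun q : E d × E d =>
      act A.1 q.1 - (inner ℝ q.2 (act A.1 q.1) : ℝ) • q.2 := by
    have h5 : ContDiff ℝ 1 fun q : E d × E d => act A.1 q.1 := (contDiff_act _).comp contDiff_fst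
    have h6 : ContDiff ℝ 1 fun q : E d × E d => (inner ℝ q.2 (act A.1 q.1) : ℝ) :=
      contDiff_snd.inner ℝ h5
    exact (h5.sub (h6.smul contDiff_snd)).locallyLipschitz
  have h7 : LocallyLipschitz V₀ := by
    have := h4.comp (h1.prodMk LocallyLipschitz.id)
    exact this
  obtain ⟨K, hK⟩ := LocallyLipschitzOn.exists_lipschitzOnWith_of_compact
    (isCompact_sphere (0 : E d) 1) h7.locallyLipschitzOn
  obtain ⟨V, hV, hVeq⟩ := hK.extend_finite_dimension
  exact ⟨V, _, hV, fun x => (hVeq x.2).symm⟩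

/-- Weak convergence of the measures pairs with uniform convergence of the integrands, since the
measures all have mass one. -/
lemma tendsto_integral_of_tendsto {l : Filter ℝ} {μ : ℝ → ProbabilityMeasure (S d)}
    {μ₀ : ProbabilityMeasure (S d)} (hμ : Tendsto μ l (𝓝 μ₀)) {F : ℝ → C(S d, ℝ)} {F₀ : C(S d, ℝ)}
    (hF : Tendsto F l (𝓝 F₀)) :
    Tendsto (fun r => ∫ x, F r x ∂(μ r : Measure (S d))) l
      (𝓝 (∫ x, F₀ x ∂(μ₀ : Measure (S d)))) := by
  have h1 : Tendsto (fun r => ∫ x, F₀ x ∂(μ r : Measure (S d))) l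
      (𝓝 (∫ x, F₀ x ∂(μ₀ : Measure (S d)))) :=
    ProbabilityMeasure.tendsto_iff_forall_integral_tendsto.1 hμ
      (BoundedContinuousFunction.mkOfCompact F₀)
  have h2 : Tendsto (fun r => ∫ x, (F r - F₀) x ∂(μ r : Measure (S d))) l (𝓝 0) := by
    refine squeeze_zero_norm (fun r => ?_) (tendsto_iff_norm_sub_tendsto_zero.1 hF)
    have := norm_integral_le_of_norm_le_const (μ := (μ r : Measure (S d))) (C := ‖F r - F₀‖)
      (Eventually.of_forall fun x => (F r - F₀).norm_coe_le_norm x)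
    simpa using this
  have h3 := h1.add h2
  rw [add_zero] at h3
  refine h3.congr fun r => ?_
  rw [← integral_add (integrable_of_continuous_sphere F₀.continuous)
    (integrable_of_continuous_sphere (F r - F₀).continuous)]
  simp

/-- Weak solutions of the continuity equation with an autonomous field `v` on `[a, b]`. -/
structure IsAutonomousSolution (v : S d → E d) (a b : ℝ) (μ : ℝ → ProbabilityMeasure (S d)) :
    Prop where
  continuousOn : ContinuousOn μ (Icc a b)
  weak : ∀ φ : E d → ℝ, ContDiff ℝ 1 φ → ∀ s t, a ≤ s → s ≤ t → t ≤ b →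
    ∫ x : S d, φ (x : E d) ∂(μ t : Measure (S d)) = ∫ x : S d, φ (x : E d) ∂(μ s : Measure (S d)) +
      ∫ r in s..t, ∫ x : S d, fderiv ℝ φ (x : E d) (v x) ∂(μ r : Measure (S d))

variable {v : S d → E d} {a b : ℝ} {μ : ℝ → ProbabilityMeasure (S d)}

/-- The restriction to the sphere of the time slice of a continuous function. -/
noncomputable def sliceMap {φ : ℝ × E d → ℝ} (hφ : Continuous φ) (t : ℝ) : C(S d, ℝ) :=
  ⟨fun x => φ (t, (x : E d)), hφ.comp (by fun_prop)⟩

lemma continuous_sliceMap {φ : ℝ × E d → ℝ} (hφ : Continuous φ) : Continuous (sliceMap hφ) := by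
  have h : Continuous fun q : ℝ × S d => φ (q.1, (q.2 : E d)) := hφ.comp (by fun_prop)
  exact (ContinuousMap.curry ⟨_, h⟩).continuous

lemma IsAutonomousSolution.continuousOn_integral (h : IsAutonomousSolution v a b μ)
    {φ : ℝ × E d → ℝ} (hφ : Continuous φ) :
    ContinuousOn (fun t => ∫ x : S d, φ (t, (x : E d)) ∂(μ t : Measure (S d))) (Icc a b) :=
  fun t ht => tendsto_integral_of_tendsto (h.continuousOn t ht)
    ((continuous_sliceMap hφ).continuousWithinAt (s := Icc a b) (x := t))

lemma IsAutonomousSolution.hasDerivWithinAt_const (h : IsAutonomousSolution v a b μ)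
    (hv : Continuous v) {φ : E d → ℝ} (hφ : ContDiff ℝ 1 φ) {t : ℝ} (ht : t ∈ Ico a b) :
    HasDerivWithinAt (fun r => ∫ x : S d, φ (x : E d) ∂(μ r : Measure (S d)))
      (∫ x : S d, fderiv ℝ φ (x : E d) (v x) ∂(μ t : Measure (S d))) (Ici t) t := by
  have hab : a ≤ b := ht.1.trans ht.2.le
  set Λ : ℝ → ℝ := fun r => ∫ x : S d, fderiv ℝ φ (x : E d) (v x) ∂(μ r : Measure (S d)) with hΛ
  have hΛc : ContinuousOn Λ (Icc a b) := fun r hr =>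
    tendsto_integral_of_tendsto (h.continuousOn r hr)
      (tendsto_const_nhds (x := (⟨_, continuous_fderiv_apply hφ hv⟩ : C(S d, ℝ))))
  set Λ' : ℝ → ℝ := fun r => Λ (projIcc a b hab r) with hΛ'
  have hΛ'c : Continuous Λ' :=
    (continuousOn_iff_continuous_domRestrict.1 hΛc).comp continuous_projIcc
  have hΛ'eq : ∀ r ∈ Icc a b, Λ' r = Λ r := fun r hr => by
    simp only [hΛ']; rw [projIcc_of_mem _ hr]
  have h1 := (intervalIntegral.integral_hasDerivAt_right (hΛ'c.intervalIntegrable t t)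
    (hΛ'c.stronglyMeasurableAtFilter _ _) hΛ'c.continuousAt).const_add
      (∫ x : S d, φ (x : E d) ∂(μ t : Measure (S d)))
  have h2 := h1.hasDerivWithinAt (s := Ici t)
  rw [hΛ'eq t (Ico_subset_Icc_self ht)] at h2
  have h3 : ∀ r ∈ Icc t b, ∫ x : S d, φ (x : E d) ∂(μ r : Measure (S d)) =
      ∫ x : S d, φ (x : E d) ∂(μ t : Measure (S d)) + ∫ r in t..r, Λ' r := by
    intro r hr
    rw [h.weak φ hφ t r ht.1 hr.1 hr.2]
    congr 1
    refine intervalIntegral.integral_congr fun s hs => ?_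
    rw [uIcc_of_le hr.1] at hs
    exact (hΛ'eq s ⟨ht.1.trans hs.1, hs.2.trans hr.2⟩).symm
  refine h2.congr_of_eventuallyEq ?_ (h3 t ⟨le_rfl, ht.2.le⟩)
  filter_upwards [Icc_mem_nhdsGE ht.2] with r hr using h3 r hr

/-- Extends the weak formulation to time-dependent test functions by splitting the increment into a
change of the function and a change of the measure. Right derivatives suffice for the mean value
inequality in `euler_step`. -/
lemma IsAutonomousSolution.hasDerivWithinAt (h : IsAutonomousSolution v a b μ) (hv : Continuous v)
    {φ : ℝ × E d → ℝ} (hφ : ContDiff ℝ 1 φ) {t : ℝ} (ht : t ∈ Ico a b) :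
    HasDerivWithinAt (fun r => ∫ x : S d, φ (r, (x : E d)) ∂(μ r : Measure (S d)))
      (∫ x : S d, fderiv ℝ φ (t, (x : E d)) (1, v x) ∂(μ t : Measure (S d))) (Ici t) t := by
  have hD : Continuous fun q : ℝ × E d => fderiv ℝ φ q (1, 0) :=
    (hφ.continuous_fderiv one_ne_zero).clm_apply continuous_const
  have hφt : ContDiff ℝ 1 fun x : E d => φ (t, x) := hφ.comp (by fun_prop)
  have hline : ∀ (s : ℝ) (x : E d), HasDerivAt (fun r => φ (r, x)) (fderiv ℝ φ (s, x) (1, 0)) s := by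
    intro s x
    have h1 := (hφ.differentiable one_ne_zero (s, x)).hasFDerivAt
    have h2 : HasDerivAt (fun r : ℝ => (r, x)) ((1 : ℝ), (0 : E d)) s :=
      (hasDerivAt_id s).prodMk (hasDerivAt_const s x)
    exact h1.comp_hasDerivAt s h2
  have hspace : ∀ (x : E d) (w : E d), fderiv ℝ (fun x : E d => φ (t, x)) x w =
      fderiv ℝ φ (t, x) (0, w) := by
    intro x w
    have h1 := (hφ.differentiable one_ne_zero (t, x)).hasFDerivAt
    have h2 : HasFDerivAt (fun x : E d => (t, x)) (ContinuousLinearMap.inr ℝ ℝ (E d)) x :=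
      hasFDerivAt_prodMk_right t x
    have h3 : HasFDerivAt (fun x : E d => φ (t, x)) _ x := h1.comp x h2
    rw [h3.fderiv]
    simp
  have hc : ∀ s, Continuous fun x : S d => φ (s, (x : E d)) := fun s =>
    hφ.continuous.comp (by fun_prop)
  have h1 := h.hasDerivWithinAt_const hv hφt ht
  have hcμ : Tendsto μ (𝓝[>] t) (𝓝 (μ t)) := by
    have := (h.continuousOn t (Ico_subset_Icc_self ht)).mono_left
      (nhdsWithin_le_iff.2 (mem_of_superset (Icc_mem_nhdsGE_of_mem ht) subset_rfl) :
        𝓝[≥] t ≤ 𝓝[Icc a b] t)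
    exact this.mono_left (nhdsWithin_mono _ Ioi_subset_Ici_self)
  have h2 : HasDerivWithinAt
      (fun r => ∫ x : S d, (φ (r, (x : E d)) - φ (t, (x : E d))) ∂(μ r : Measure (S d)))
      (∫ x : S d, fderiv ℝ φ (t, (x : E d)) (1, 0) ∂(μ t : Measure (S d))) (Ici t) t := by
    rw [← hasDerivWithinAt_Ioi_iff_Ici, hasDerivWithinAt_iff_tendsto_slope' (by simp)]
    set F : ℝ → C(S d, ℝ) := fun r =>
      (r - t)⁻¹ • (sliceMap hφ.continuous r - sliceMap hφ.continuous t) with hF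
    -- The difference quotients converge uniformly on the sphere: the time derivative varies by at
    -- most `ε / 2` uniformly in `x` for nearby times, and the mean value inequality applies.
    have hFlim : Tendsto F (𝓝[>] t) (𝓝 (sliceMap hD t)) := by
      rw [Metric.tendsto_nhds]
      intro ε hε
      have h3 := Metric.continuousAt_iff.1 ((continuous_sliceMap hD).continuousAt (x := t)) (ε / 2)
        (half_pos hε)
      obtain ⟨δ, hδ, h3⟩ := h3
      have h4 : ∀ᶠ r in 𝓝[>] t, r ∈ Ioo t (t + δ) := Ioo_mem_nhdsGT (by linarith)
      filter_upwards [h4] with r hr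
      refine lt_of_le_of_lt ((ContinuousMap.dist_le (half_pos hε).le).2 fun x => ?_)
        (half_lt_self hε)
      have hrt : 0 < r - t := sub_pos.2 hr.1
      have h5 := norm_image_sub_le_of_norm_deriv_le_segment' (a := t) (b := r)
        (f := fun s => φ (s, (x : E d)) - s * fderiv ℝ φ (t, (x : E d)) (1, 0))
        (f' := fun s => fderiv ℝ φ (s, (x : E d)) (1, 0) - fderiv ℝ φ (t, (x : E d)) (1, 0))
        (C := ε / 2) (fun s _ => by
          have := ((hline s x).sub ((hasDerivAt_id s).mul_const
            (fderiv ℝ φ (t, (x : E d)) (1, 0)))).hasDerivWithinAt (s := Icc t r)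
          rw [one_mul] at this
          exact this)
        (fun s hs => by
          have h6 : dist s t < δ := by
            rw [Real.dist_eq, abs_of_nonneg (by linarith [hs.1])]
            linarith [hs.2, hr.2]
          have h7 := (ContinuousMap.dist_apply_le_dist x).trans (h3 h6).le
          rwa [Real.dist_eq] at h7) r ⟨hr.1.le, le_rfl⟩
      have h8 : (F r) x - sliceMap hD t x = (r - t)⁻¹ * (φ (r, (x : E d)) -
          r * fderiv ℝ φ (t, (x : E d)) (1, 0) - (φ (t, (x : E d)) -
          t * fderiv ℝ φ (t, (x : E d)) (1, 0))) := by
        simp only [hF, sliceMap, ContinuousMap.smul_apply, ContinuousMap.sub_apply,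
          ContinuousMap.coe_mk, smul_eq_mul]
        field_simp
        ring
      rw [Real.dist_eq, h8, abs_mul, abs_of_pos (inv_pos.2 hrt), inv_mul_le_iff₀ hrt,
        mul_comm (r - t)]
      exact h5
    have h9 := tendsto_integral_of_tendsto hcμ hFlim
    refine h9.congr' ?_
    filter_upwards with r
    rw [slope_def_field]
    simp only [sub_self, integral_zero, sub_zero]
    rw [div_eq_inv_mul, ← integral_const_mul]
    rfl
  have h3 := h2.add h1
  have hsum : ∫ x : S d, fderiv ℝ φ (t, (x : E d)) (1, 0) ∂(μ t : Measure (S d)) +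
      ∫ x : S d, fderiv ℝ (fun x : E d => φ (t, x)) (x : E d) (v x) ∂(μ t : Measure (S d)) =
      ∫ x : S d, fderiv ℝ φ (t, (x : E d)) (1, v x) ∂(μ t : Measure (S d)) := by
    have hc1 : Continuous fun x : S d => fderiv ℝ φ (t, (x : E d)) (1, 0) :=
      (sliceMap hD t).continuous
    rw [← integral_add (integrable_of_continuous_sphere hc1)
      (integrable_of_continuous_sphere (continuous_fderiv_apply hφt hv))]
    refine integral_congr_ae (Eventually.of_forall fun x => ?_)
    simp only [hspace, ← map_add]
    simp
  rw [hsum] at h3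
  refine h3.congr_of_eventuallyEq ?_ ?_
  · filter_upwards with r
    simp only [Pi.add_apply]
    rw [integral_sub (integrable_of_continuous_sphere (hc r))
      (integrable_of_continuous_sphere (hc t))]
    ring
  · simp

/-- One explicit Euler step for the dual transport equation. -/
lemma IsAutonomousSolution.euler_step (h : IsAutonomousSolution v a b μ) (hv : Continuous v)
    {M δ : ℝ} (hM : ∀ x, ‖v x‖ ≤ M) {u : E d → E d} {K ℓ : ℝ≥0} (hu : ContDiff ℝ 1 u)
    (huK : LipschitzWith K u) (huv : ∀ x : S d, ‖u x - v x‖ ≤ δ) {χ : E d → ℝ}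
    (hχ : ContDiff ℝ 1 χ) (hχℓ : LipschitzWith ℓ χ) {s t : ℝ} (has : a ≤ s) (hst : s ≤ t)
    (htb : t ≤ b) :
    |∫ x : S d, χ (x : E d) ∂(μ t : Measure (S d)) -
      ∫ x : S d, χ ((x : E d) + (t - s) • u x) ∂(μ s : Measure (S d))| ≤
        (t - s) * (ℓ * (δ + (t - s) * K * M)) := by
  -- This almost solves the backward transport equation with final value `χ`. Its derivative along
  -- `(1, v)` is `Dχ (v - u + (t - r) • Du v)`, which is small and involves only first derivatives.
  set φ : ℝ × E d → ℝ := fun q => χ (q.2 + (t - q.1) • u q.2) with hφdef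
  have hφ : ContDiff ℝ 1 φ := by
    have hu' : ContDiff ℝ 1 fun q : ℝ × E d => u q.2 := hu.comp contDiff_snd
    exact hχ.comp (by fun_prop)
  have hder : ∀ (r : ℝ) (x w : E d), fderiv ℝ φ (r, x) (1, w) =
      fderiv ℝ χ (x + (t - r) • u x) (w - u x + (t - r) • fderiv ℝ u x w) := by
    intro r x w
    have h1 := (hφ.differentiable one_ne_zero (r, x)).hasFDerivAt
    have hl : HasDerivAt (fun s : ℝ => (r + s, x + s • w)) ((1 : ℝ), w) 0 := by
      refine HasDerivAt.prodMk ?_ ?_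
      · simpa using (hasDerivAt_id (0 : ℝ)).const_add r
      · simpa using ((hasDerivAt_id (0 : ℝ)).smul_const w).const_add x
    have h2 : HasDerivAt (fun s : ℝ => φ (r + s, x + s • w)) (fderiv ℝ φ (r, x) (1, w)) 0 := by
      have h1' : HasFDerivAt φ (fderiv ℝ φ (r, x)) (r + 0, x + (0 : ℝ) • w) := by simpa using h1
      exact h1'.comp_hasDerivAt 0 hl
    have hline : HasDerivAt (fun s : ℝ => x + s • w) w 0 := by
      simpa using ((hasDerivAt_id (0 : ℝ)).smul_const w).const_add x
    have h3 : HasDerivAt (fun s : ℝ => u (x + s • w)) (fderiv ℝ u x w) 0 := by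
      have h1' : HasFDerivAt u (fderiv ℝ u x) (x + (0 : ℝ) • w) := by
        simpa using (hu.differentiable one_ne_zero x).hasFDerivAt
      exact h1'.comp_hasDerivAt 0 hline
    have h4 : HasDerivAt (fun s : ℝ => t - (r + s)) (-1) 0 := by
      simpa using ((hasDerivAt_id (0 : ℝ)).const_add r).const_sub t
    have h5 : HasDerivAt (fun s : ℝ => x + s • w + (t - (r + s)) • u (x + s • w))
        (w - u x + (t - r) • fderiv ℝ u x w) 0 := by
      have := hline.add (h4.smul h3)
      have e : w + ((t - (r + 0)) • fderiv ℝ u x w + (-1 : ℝ) • u (x + (0 : ℝ) • w)) =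
          w - u x + (t - r) • fderiv ℝ u x w := by
        rw [add_zero, zero_smul, add_zero, neg_one_smul]
        abel
      rw [e] at this
      exact this
    have h6 : HasDerivAt (fun s : ℝ => φ (r + s, x + s • w))
        (fderiv ℝ χ (x + (t - r) • u x) (w - u x + (t - r) • fderiv ℝ u x w)) 0 := by
      have h1' : HasFDerivAt χ (fderiv ℝ χ (x + (t - r) • u x))
          (x + (0 : ℝ) • w + (t - (r + 0)) • u (x + (0 : ℝ) • w)) := by
        simpa using (hχ.differentiable one_ne_zero (x + (t - r) • u x)).hasFDerivAt
      exact h1'.comp_hasDerivAt 0 h5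
    exact h2.unique h6
  have hbound : ∀ r ∈ Ico s t,
      ‖∫ x : S d, fderiv ℝ φ (r, (x : E d)) (1, v x) ∂(μ r : Measure (S d))‖ ≤
        ℓ * (δ + (t - s) * K * M) := by
    intro r hr
    have h1 : ∀ x : S d, ‖fderiv ℝ φ (r, (x : E d)) (1, v x)‖ ≤ ℓ * (δ + (t - s) * K * M) := by
      intro x
      rw [hder]
      have h2 := norm_fderiv_le_of_lipschitz ℝ hχℓ (x₀ := (x : E d) + (t - r) • u x)
      have h3 := norm_fderiv_le_of_lipschitz ℝ huK (x₀ := (x : E d))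
      have h4 : ‖v x - u x + (t - r) • fderiv ℝ u x (v x)‖ ≤ δ + (t - s) * K * M := by
        refine (norm_add_le _ _).trans (add_le_add ?_ ?_)
        · rw [norm_sub_rev]; exact huv x
        · rw [norm_smul, Real.norm_eq_abs, abs_of_nonneg (by linarith [hr.2]), mul_assoc]
          have h5 : ‖fderiv ℝ u x (v x)‖ ≤ K * M :=
            (ContinuousLinearMap.le_opNorm _ _).trans
              (mul_le_mul h3 (hM x) (norm_nonneg _) K.2)
          exact mul_le_mul (by linarith [hr.1]) h5 (norm_nonneg _) (by linarith)
      exact (ContinuousLinearMap.le_opNorm _ _).trans (mul_le_mul h2 h4 (norm_nonneg _) ℓ.2)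
    have := norm_integral_le_of_norm_le_const (μ := (μ r : Measure (S d)))
      (Eventually.of_forall h1)
    simpa using this
  have h1 := norm_image_sub_le_of_norm_deriv_right_le_segment
    ((h.continuousOn_integral hφ.continuous).mono (Icc_subset_Icc has htb))
    (fun r hr => h.hasDerivWithinAt hv hφ ⟨has.trans hr.1, hr.2.trans_le htb⟩) hbound t
    ⟨hst, le_rfl⟩
  simp only [hφdef, sub_self, zero_smul, add_zero, Real.norm_eq_abs] at h1
  linarith

/-- Each step replaces `χ` by `χ ∘ (id + c u)`, multiplying its Lipschitz constant by at most `1 + c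
K`; the one-step errors then add up. The comparison integral depends only on `μ a`, so two solutions
with the same datum share it. -/
lemma IsAutonomousSolution.euler_iterate (h : IsAutonomousSolution v a b μ) (hv : Continuous v)
    {M δ : ℝ} (hM0 : 0 ≤ M) (hM : ∀ x, ‖v x‖ ≤ M) {u : E d → E d} {K : ℝ≥0} (hu : ContDiff ℝ 1 u)
    (huK : LipschitzWith K u) (hδ : 0 ≤ δ) (huv : ∀ x : S d, ‖u x - v x‖ ≤ δ) {c : ℝ} (hc : 0 ≤ c)
    (j : ℕ) (hj : a + j * c ≤ b) {χ : E d → ℝ} (hχ : ContDiff ℝ 1 χ) {ℓ : ℝ≥0}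
    (hχℓ : LipschitzWith ℓ χ) :
    |∫ x : S d, χ (x : E d) ∂(μ (a + j * c) : Measure (S d)) -
      ∫ x : S d, χ ((fun y : E d => y + c • u y)^[j] x) ∂(μ a : Measure (S d))| ≤
        j * c * (ℓ * (1 + c * K) ^ j * (δ + c * K * M)) := by
  induction j generalizing χ ℓ with
  | zero => simp
  | succ j ih =>
    have hK : (0 : ℝ) ≤ K := K.2
    have hℓ : (0 : ℝ) ≤ ℓ := ℓ.2
    have hcast : ((j + 1 : ℕ) : ℝ) = j + 1 := by push_cast; ring
    have hj' : a + j * c ≤ b := by rw [hcast] at hj; linarith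
    have h1 := h.euler_step hv hM hu huK huv hχ hχℓ (s := a + j * c) (t := a + (j + 1 : ℕ) * c)
      (le_add_of_nonneg_right (by positivity)) (by rw [hcast]; linarith) hj
    have e : a + (j + 1 : ℕ) * c - (a + j * c) = c := by rw [hcast]; ring
    rw [e] at h1
    have hG : ContDiff ℝ 1 fun y : E d => y + c • u y := contDiff_id.add (hu.const_smul c)
    have hGL : LipschitzWith (1 + c.toNNReal * K) fun y : E d => y + c • u y := by
      have h2 : LipschitzWith (c.toNNReal * K) fun y : E d => c • u y := by
        refine LipschitzWith.of_dist_le_mul fun x y => ?_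
        rw [dist_smul₀, Real.norm_of_nonneg hc, NNReal.coe_mul, Real.coe_toNNReal _ hc, mul_assoc]
        exact mul_le_mul_of_nonneg_left (huK.dist_le_mul x y) hc
      exact LipschitzWith.id.add h2
    have hχG : ContDiff ℝ 1 fun y : E d => χ (y + c • u y) := hχ.comp hG
    have hχGL : LipschitzWith (ℓ * (1 + c.toNNReal * K)) fun y : E d => χ (y + c • u y) :=
      hχℓ.comp hGL
    have h3 := ih hj' hχG hχGL
    simp only [NNReal.coe_mul, NNReal.coe_add, NNReal.coe_one, Real.coe_toNNReal _ hc] at h3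
    simp only [Function.iterate_succ_apply']
    refine (abs_sub_le _ _ _).trans ((add_le_add h1 h3).trans ?_)
    have hp : (1 : ℝ) ≤ (1 + c * K) ^ (j + 1) :=
      one_le_pow₀ (le_add_of_nonneg_right (by positivity))
    have hq : 0 ≤ c * (ℓ * (δ + c * K * M)) := by positivity
    have h4 := mul_le_mul_of_nonneg_right hp hq
    rw [hcast]
    have e2 : (j : ℝ) * c * (ℓ * (1 + c * K) * (1 + c * K) ^ j * (δ + c * K * M)) =
      j * c * (ℓ * (1 + c * K) ^ (j + 1) * (δ + c * K * M)) := by ring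
    rw [e2]
    linarith

/-- Solutions for a field that is the restriction of a Lipschitz map of the ambient space are
determined by their initial datum. -/
theorem IsAutonomousSolution.unique {ν : ℝ → ProbabilityMeasure (S d)}
    (hμ : IsAutonomousSolution v a b μ) (hν : IsAutonomousSolution v a b ν) (hab : a ≤ b)
    {V : E d → E d} {K : ℝ≥0} (hV : LipschitzWith K V) (hVv : ∀ x : S d, V x = v x)
    (h0 : μ a = ν a) : μ b = ν b := by
  have hv : Continuous v := by
    have h1 : v = fun x : S d => V x := funext fun x => (hVv x).symm
    rw [h1]
    exact hV.continuous.comp continuous_subtype_val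
  obtain ⟨M, hM⟩ := (isCompact_univ (X := S d)).exists_bound_of_continuousOn hv.continuousOn
  have hM' : ∀ x, ‖v x‖ ≤ |M| := fun x => (hM x (mem_univ x)).trans (le_abs_self M)
  have key : ∀ χ : E d → ℝ, ContDiff ℝ 1 χ → ∀ ℓ : ℝ≥0, LipschitzWith ℓ χ →
      ∫ x : S d, χ x ∂(μ b : Measure (S d)) = ∫ x : S d, χ x ∂(ν b : Measure (S d)) := by
    intro χ hχ ℓ hℓ
    set D := |∫ x : S d, χ x ∂(μ b : Measure (S d)) - ∫ x : S d, χ x ∂(ν b : Measure (S d))| with hD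
    -- Taking `n + 1` steps and mollification error `1 / (n + 1)`, the growth `(1 + c K) ^ (n + 1)`
    -- is at most the exponential, and the rest is of order `1 / (n + 1)`. The factor `2` counts the
    -- two solutions.
    set C : ℝ := 2 * ((b - a) * (ℓ * Real.exp (K * (b - a)) * (1 + (b - a) * K * |M|))) with hC
    have hle : ∀ n : ℕ, D ≤ C * (1 / ((n : ℝ) + 1)) := by
      intro n
      have hn : (0 : ℝ) < n + 1 := by positivity
      obtain ⟨u, hu, huK, huV⟩ := exists_contDiff_lipschitz_approx hV (one_div_pos.2 hn)
      have huv : ∀ x : S d, ‖u x - v x‖ ≤ 1 / ((n : ℝ) + 1) := fun x => by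
        rw [← hVv]; exact huV x
      set c : ℝ := (b - a) / (n + 1) with hcdef
      have hc : 0 ≤ c := div_nonneg (sub_nonneg.2 hab) hn.le
      have hcast : ((n + 1 : ℕ) : ℝ) = n + 1 := by push_cast; ring
      have hnc : ((n + 1 : ℕ) : ℝ) * c = b - a := by rw [hcast, hcdef]; field_simp
      have hb : a + ((n + 1 : ℕ) : ℝ) * c = b := by rw [hnc]; ring
      have h1 := hμ.euler_iterate hv (abs_nonneg M) hM' hu huK (one_div_pos.2 hn).le huv hc (n + 1)
        hb.le hχ hℓ
      have h2 := hν.euler_iterate hv (abs_nonneg M) hM' hu huK (one_div_pos.2 hn).le huv hc (n + 1)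
        hb.le hχ hℓ
      rw [hb, hnc] at h1 h2
      rw [← h0] at h2
      have hpow : (1 + c * K) ^ (n + 1) ≤ Real.exp (K * (b - a)) := by
        have : (1 + c * K : ℝ) ≤ Real.exp (c * K) := by
          rw [add_comm]; exact Real.add_one_le_exp _
        refine (pow_le_pow_left₀ (by positivity) this _).trans_eq ?_
        rw [← Real.exp_nat_mul, ← mul_assoc, hnc, mul_comm]
      have hba : 0 ≤ b - a := sub_nonneg.2 hab
      have h3 : (b - a) * (ℓ * (1 + c * K) ^ (n + 1) * (1 / ((n : ℝ) + 1) + c * K * |M|)) ≤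
          (b - a) * (ℓ * Real.exp (K * (b - a)) * (1 / ((n : ℝ) + 1) + c * K * |M|)) := by
        gcongr
      have h4 : C * (1 / ((n : ℝ) + 1)) =
          2 * ((b - a) * (ℓ * Real.exp (K * (b - a)) * (1 / ((n : ℝ) + 1) + c * K * |M|))) := by
        rw [hC, hcdef]; field_simp
      rw [h4]
      refine (abs_sub_le _ _ _).trans ((add_le_add h1 ((abs_sub_comm _ _).trans_le h2)).trans ?_)
      linarith
    have hlim : Tendsto (fun n : ℕ => C * (1 / ((n : ℝ) + 1))) atTop (𝓝 0) := by
      simpa using tendsto_one_div_add_atTop_nhds_zero_nat.const_mul C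
    have hD0 : D ≤ 0 := ge_of_tendsto' hlim hle
    exact sub_eq_zero.1 (abs_nonpos_iff.1 hD0)
  refine Subtype.ext (show (μ b : Measure (S d)) = (ν b : Measure (S d)) from ?_)
  refine (MeasurableEmbedding.subtype_coe
    (Metric.isClosed_sphere (x := (0 : E d)) (ε := 1)).measurableSet).map_injective ?_
  have hpm : ∀ ρ : ProbabilityMeasure (S d),
      IsProbabilityMeasure ((ρ : Measure (S d)).map ((↑) : S d → E d)) := fun ρ =>
    Measure.isProbabilityMeasure_map measurable_subtype_coe.aemeasurable
  have := hpm (μ b)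
  have := hpm (ν b)
  -- The real and imaginary parts of the characteristic function integrate `cos ⟪t, x⟫` and `sin ⟪t,
  -- x⟫`, which are `C¹` and Lipschitz, so `key` applies to them.
  refine Measure.ext_of_charFun (funext fun t => ?_)
  have hchar : ∀ ρ : ProbabilityMeasure (S d),
      charFun ((ρ : Measure (S d)).map ((↑) : S d → E d)) t =
        ((∫ x : S d, Real.cos (inner ℝ t (x : E d)) ∂(ρ : Measure (S d)) : ℝ) : ℂ) +
        ((∫ x : S d, Real.sin (inner ℝ t (x : E d)) ∂(ρ : Measure (S d)) : ℝ) : ℂ) * Complex.I := by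
    intro ρ
    have hin : Continuous fun x : S d => (inner ℝ t (x : E d) : ℝ) := by fun_prop
    have hcos := integrable_of_continuous_sphere (μ := (ρ : Measure (S d)))
      (Real.continuous_cos.comp hin)
    have hsin := integrable_of_continuous_sphere (μ := (ρ : Measure (S d)))
      (Real.continuous_sin.comp hin)
    rw [charFun_apply, integral_map measurable_subtype_coe.aemeasurable
      (by fun_prop : Continuous fun x : E d => Complex.exp ((inner ℝ x t : ℝ) * Complex.I)
        ).aestronglyMeasurable]
    have hcos' : Integrable (fun x : S d => ((Real.cos (inner ℝ t (x : E d)) : ℝ) : ℂ))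
        (ρ : Measure (S d)) := hcos.ofReal
    have hsin' : Integrable (fun x : S d => ((Real.sin (inner ℝ t (x : E d)) : ℝ) : ℂ))
        (ρ : Measure (S d)) := hsin.ofReal
    rw [← integral_complex_ofReal, ← integral_complex_ofReal, ← integral_mul_const,
      ← integral_add hcos' (hsin'.mul_const _)]
    refine integral_congr_ae (Eventually.of_forall fun x => ?_)
    beta_reduce
    rw [Complex.exp_mul_I, real_inner_comm]
    push_cast
    rfl
  have hL : ContDiff ℝ 1 fun x : E d => (inner ℝ t x : ℝ) := contDiff_const.inner ℝ contDiff_id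
  have hLL : LipschitzWith ‖innerSL ℝ t‖₊ fun x : E d => (inner ℝ t x : ℝ) :=
    (innerSL ℝ t).lipschitz
  have hcos := key (fun x => Real.cos (inner ℝ t x)) (Real.contDiff_cos.comp hL) _
    (Real.lipschitzWith_cos.comp hLL)
  have hsin := key (fun x => Real.sin (inner ℝ t x)) (Real.contDiff_sin.comp hL) _
    (Real.lipschitzWith_sin.comp hLL)
  rw [hchar, hchar, hcos, hsin]

/-- On the time interval of a layer, a weak solution is a solution for the field of that layer. -/
lemma IsWeakSolution.isAutonomousSolution {τ : ℝ} (hτ : 0 < τ) {n : ℕ} {A : ℕ → Layer d}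
    {B : ℝ → Matrix (Fin d) (Fin d) ℝ} {μ₀ : ProbabilityMeasure (S d)}
    (h : IsWeakSolution (n * τ) (schedule τ A B) μ₀ μ) {k : ℕ} (hk : k < n) :
    IsAutonomousSolution (A k).vel (k * τ) ((k + 1) * τ) μ := by
  have hk0 : 0 ≤ (k : ℝ) * τ := by positivity
  have hkn : ((k : ℝ) + 1) * τ ≤ n * τ := by
    have : ((k : ℝ) + 1) ≤ n := by exact_mod_cast hk
    exact mul_le_mul_of_nonneg_right this hτ.le
  refine ⟨h.continuousOn.mono (Icc_subset_Icc hk0 hkn), fun φ hφ s t hs hst ht => ?_⟩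
  have hs0 : 0 ≤ s := hk0.trans hs
  have htn : t ≤ n * τ := ht.trans hkn
  have hi := h.integrable φ hφ
  have hnτ : 0 ≤ n * τ := hs0.trans (hst.trans htn)
  have h1 := intervalIntegral.integral_add_adjacent_intervals
    (hi.mono_set (c := 0) (d := s) (by
      rw [uIcc_of_le hs0, uIcc_of_le hnτ]; exact Icc_subset_Icc_right (hst.trans htn)))
    (hi.mono_set (c := s) (d := t) (by
      rw [uIcc_of_le hst, uIcc_of_le hnτ]; exact Icc_subset_Icc hs0 htn))
  rw [h.weak φ hφ t ⟨hs0.trans hst, htn⟩, h.weak φ hφ s ⟨hs0, hst.trans htn⟩, ← h1, ← add_assoc]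
  congr 1
  refine intervalIntegral.integral_congr_Ioo_of_le hst fun r hr => ?_
  have hr' : ⌊r / τ⌋₊ = k :=
    floor_eq_of_mem_Ico hτ ⟨hs.trans hr.1.le, hr.2.trans_le ht⟩
  simp only [velocity_schedule, hr']

/-- Weak solutions for a piecewise constant schedule of layers are unique. -/
theorem IsWeakSolution.unique {τ : ℝ} (hτ : 0 < τ) {n : ℕ} {A : ℕ → Layer d}
    {B : ℝ → Matrix (Fin d) (Fin d) ℝ} {μ₀ : ProbabilityMeasure (S d)}
    {ν : ℝ → ProbabilityMeasure (S d)} (hμ : IsWeakSolution (n * τ) (schedule τ A B) μ₀ μ)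
    (hν : IsWeakSolution (n * τ) (schedule τ A B) μ₀ ν) : μ (n * τ) = ν (n * τ) := by
  suffices h : ∀ k ≤ n, μ (k * τ) = ν (k * τ) from h n le_rfl
  intro k
  induction k with
  | zero => intro _; rw [Nat.cast_zero, zero_mul, hμ.initial, hν.initial]
  | succ k ih =>
    intro hk
    obtain ⟨V, K, hV, hVv⟩ := (A k).exists_lipschitz_extension
    push_cast
    exact (hμ.isAutonomousSolution hτ hk).unique (hν.isAutonomousSolution hτ hk)
      (by nlinarith) hV hVv (ih (Nat.le_of_succ_le hk))

/-! ### Handling all data at once, and conclusion. -/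

/-- Compose the maps: on `C i` only `g i` acts, because `g i` keeps its points in `C i`, where the
other maps are the identity. -/
lemma exists_simultaneous {ι : Type*} [DecidableEq ι] {C : ι → Set (S d)} {g : ι → S d → S d}
    (hg : ∀ i, Realizable (g i)) (hgC : ∀ i, ∀ z ∈ C i, g i z ∈ C i)
    (hfix : ∀ i j, i ≠ j → ∀ z ∈ C j, g i z = z) (s : Finset ι) :
    ∃ Ψ, Realizable Ψ ∧ (∀ i ∈ s, ∀ z ∈ C i, Ψ z = g i z) ∧ ∀ i ∉ s, ∀ z ∈ C i, Ψ z = z := by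
  induction s using Finset.induction_on with
  | empty => exact ⟨_, Realizable.id, by simp, fun _ _ _ _ => rfl⟩
  | insert i s his ih =>
    obtain ⟨Ψ, hΨ, h1, h2⟩ := ih
    refine ⟨fun z => g i (Ψ z), (hg i).comp hΨ, fun j hj z hz => ?_, fun j hj z hz => ?_⟩ <;>
      beta_reduce
    · rcases Finset.mem_insert.1 hj with rfl | hj
      · rw [h2 j his z hz]
      · have hij : i ≠ j := fun h => his (h ▸ hj)
        rw [h1 j hj z hz, hfix i j hij _ (hgC j z hz)]
    · have hij : i ≠ j := fun h => hj (h ▸ Finset.mem_insert_self _ _)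
      rw [h2 j (fun h => hj (Finset.mem_insert_of_mem h)) z hz, hfix i j hij z hz]

lemma piecewiseConstant_floor {α : Type*} {n : ℕ} {τ : ℝ} (hτ : 0 < τ) (f : ℕ → α) :
    PiecewiseConstant (n * τ) fun t => f ⌊t / τ⌋₊ := by
  refine ⟨n, fun k => (k : ℕ) * τ, fun i j hij => ?_, by simp, by simp, fun k => ⟨f k, ?_⟩⟩
  · have : ((i : ℕ) : ℝ) < (j : ℕ) := by exact_mod_cast hij
    exact mul_lt_mul_of_pos_right this hτ
  · intro s hs
    simp only [Fin.val_castSucc, Fin.val_succ, Nat.cast_add, Nat.cast_one] at hs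
    simp only [floor_eq_of_mem_Ico hτ hs]

end TransformerFlow

open TransformerFlow in
theorem proposition2p2 (d N M : ℕ) (hM : 1 ≤ M)
    (μ₀ : Fin N → ProbabilityMeasure (TransformerFlow.S d))
    (hatom : ∀ i (y : TransformerFlow.S d), (μ₀ i : Measure (TransformerFlow.S d)) {y} = 0)
    (hdisj : ∀ i j, i ≠ j →
      Disjoint (TransformerFlow.geodHull (μ₀ i : Measure (TransformerFlow.S d)).support)
        (TransformerFlow.geodHull (μ₀ j : Measure (TransformerFlow.S d)).support))
    (α : Fin N → Fin M → ℝ) (hα : ∀ i k, 0 ≤ α i k) (hα1 : ∀ i, ∑ k, α i k = 1)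
    (x : Fin N → Fin M → TransformerFlow.S d)
    (hx : ∀ i k, x i k ∈
      TransformerFlow.geodHull (μ₀ i : Measure (TransformerFlow.S d)).support)
    (hxinj : ∀ i j k k', x i k = x j k' ↔ (k, i) = (k', j))
    (T ε : ℝ) (hT : 0 < T) (hε : 0 < ε) :
    ∃ (W U : ℝ → Matrix (Fin d) (Fin d) ℝ) (b : ℝ → TransformerFlow.E d),
      TransformerFlow.PiecewiseConstant T (fun t => (W t, U t, b t)) ∧
      ∀ B : ℝ → Matrix (Fin d) (Fin d) ℝ,
        (∀ i, ∃ μ : ℝ → ProbabilityMeasure (TransformerFlow.S d),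
          TransformerFlow.IsWeakSolution T (fun t => ⟨0, B t, W t, U t, b t⟩) (μ₀ i) μ) ∧
        ∀ μ : Fin N → ℝ → ProbabilityMeasure (TransformerFlow.S d),
          (∀ i, TransformerFlow.IsWeakSolution T
            (fun t => ⟨0, B t, W t, U t, b t⟩) (μ₀ i) (μ i)) →
          (∀ i, TransformerFlow.wasserstein2 (μ i T : Measure (TransformerFlow.S d))
              (∑ k, ENNReal.ofReal (α i k) • Measure.dirac (x i k)) ≤ ENNReal.ofReal ε) ∧
          ∀ i j, i ≠ j →
            Disjoint
              (TransformerFlow.geodHull (μ i T : Measure (TransformerFlow.S d)).support)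
              (TransformerFlow.geodHull (μ j T : Measure (TransformerFlow.S d)).support) := by
  set C : Fin N → Set (S d) := fun i => geodHull (μ₀ i : Measure (S d)).support with hC
  have hCc : ∀ i, IsClosed (C i) := fun i => isClosed_geodHull Measure.isClosed_support
  have hμC : ∀ i, (μ₀ i : Measure (S d)) (C i)ᶜ = 0 := fun i =>
    measure_mono_null (compl_subset_compl.2 (subset_geodHull _)) Measure.measure_compl_support
  have hsteer := fun i => exists_steering (μ₀ i : Measure (S d)) (hatom i) (hCc i)
    (geodConvex_geodHull _) (hμC i) (F := ⋃ j ∈ ({i}ᶜ : Set (Fin N)), C j)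
    ((toFinite _).isClosed_biUnion fun j _ => hCc j)
    (disjoint_iUnion₂_right.2 fun j hj => hdisj i j fun h => hj h.symm)
    (hα i) (hα1 i) (hx i) (fun k k' h => (Prod.ext_iff.1 ((hxinj i i k k').1 h)).1) hε
  choose g hg hgF hgC hgW using hsteer
  obtain ⟨Ψ, hΨ, hΨg, -⟩ := exists_simultaneous hg hgC
    (fun i j hij z hz => hgF i z (mem_biUnion (fun h => hij h.symm) hz)) Finset.univ
  obtain ⟨n, hn, htraj⟩ := hΨ.exists_trajectory
  have hn0 : (0 : ℝ) < n := by exact_mod_cast hn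
  set τ := T / n with hτdef
  have hτ : 0 < τ := div_pos hT hn0
  have hnτ : n * τ = T := by rw [hτdef]; field_simp
  obtain ⟨A, X, hX, hXΨ⟩ := htraj τ hτ
  refine ⟨fun t => (A ⌊t / τ⌋₊).1, fun t => (A ⌊t / τ⌋₊).2.1, fun t => (A ⌊t / τ⌋₊).2.2, ?_,
    fun B => ⟨fun i => ⟨_, hnτ ▸ hX.isWeakSolution hτ B (μ₀ i)⟩, fun μ hμ => ?_⟩⟩
  · rw [← hnτ]
    exact piecewiseConstant_floor hτ A
  have hae : ∀ i, ∀ᵐ z ∂(μ₀ i : Measure (S d)), z ∈ C i := fun i => mem_ae_iff.2 (hμC i)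
  -- Uniqueness identifies an arbitrary weak solution at time `T` with the push-forward by `Ψ`,
  -- which agrees with `g i` almost everywhere for `μ₀ i`.
  have hfinal : ∀ i, (μ i T : Measure (S d)) = (μ₀ i : Measure (S d)).map (g i) := by
    intro i
    have h1 : IsWeakSolution (n * τ) (schedule τ A B) (μ₀ i) (μ i) := by rw [hnτ]; exact hμ i
    have h2 := h1.unique hτ (hX.isWeakSolution hτ B (μ₀ i))
    rw [hnτ] at h2
    rw [h2, ProbabilityMeasure.toMeasure_map]
    refine Measure.map_congr ?_
    filter_upwards [hae i] with z hz
    rw [hXΨ T hnτ.le z, hΨg i (Finset.mem_univ i) z hz]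
  -- The final measure is carried by the closed geodesically convex set `C i`, so disjointness is
  -- inherited from the initial hulls.
  have hsupp : ∀ i, geodHull (μ i T : Measure (S d)).support ⊆ C i := by
    intro i
    refine geodHull_subset (Measure.support_subset_of_isClosed (hCc i) ?_) (geodConvex_geodHull _)
    rw [hfinal]
    refine (mem_ae_map_iff (hg i).continuous.measurable.aemeasurable (hCc i).measurableSet).2 ?_
    filter_upwards [hae i] with z hz using hgC i z hz
  exact ⟨fun i => by rw [hfinal]; exact hgW i,
    fun i j hij => (hdisj i j hij).mono (hsupp i) (hsupp j)⟩
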